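/- Let $P(G,x)$ denote the number of proper colorings of a finite simple graph $G$ with $x$ colors (the chromatic polynomial of $G$), let $(y)_m = y(y-1)\cdots(y-m+1)$, and for $n>k\ge 2$ let $G_{n,k}$ be the graph on $n$ vertices obtained from a $k$-clique by adding a path with $n-k$ internal vertices, each of degree $2$, joining two distinct vertices of the clique. Let $G$ be a $2$-connected graph of order $n$ with chromatic number $k$, where $n>k\ge 4$, and suppose that the independence number and the (vertex) connectivity of $G$ satisfy $\alpha(G)=\kappa(G)=2$. Then for every integer $x\ge k$, $$P(G,x)\le (x-1)_{k-1}\big((x-1)^{n-k+1}+(-1)^{n-k}\big),$$ with equality if and only if $G\cong G_{k+1,k}$ or $G\cong G_{k+2,k}$. -/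

import Mathlib

namespace SimpleGraph

/-- `G` is `l`-connected: it has more than `l` vertices, and deleting fewer than `l` vertices
always leaves a connected graph. -/
def IsVertexConnected {V : Type*} [Fintype V] (G : SimpleGraph V) (l : ℕ) : Prop :=
  l < Fintype.card V ∧
    ∀ S : Finset V, S.card < l → (G.induce {v : V | v ∉ S}).Connected

/-- The (vertex) connectivity `κ(G)`: the maximum `l` for which `G` is `l`-connected.
The set is bounded by the number of vertices, and it contains `0` if there is a vertex. -/
noncomputable def vertexConnectivity {V : Type*} [Fintype V] (G : SimpleGraph V) : ℕ :=
  sSup {l : ℕ | G.IsVertexConnected l}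

/-- `P(G, x)` for a natural number `x`: the number of proper colorings of `G` with the `x` colors
of `Fin x`. -/
noncomputable def numColorings {V : Type*} (G : SimpleGraph V) (x : ℕ) : ℕ :=
  Nat.card (G.Coloring (Fin x))

/-- The graph `G_{n,k}` (for `n > k ≥ 2`) on the vertices `0, …, n - 1`: the vertices
`0, …, k - 1` form a clique, and the path `k - 1, k, k + 1, …, n - 1, 0` is an ear, with the
`n - k` internal vertices `k, …, n - 1`, attached to the distinct clique vertices `k - 1`
and `0`. (The remaining edges `i, i + 1` with `i + 1 < k` lie in the clique anyway;
`fromRel` makes the relation symmetric and irreflexive.) -/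
def cliqueWithEar (n k : ℕ) : SimpleGraph (Fin n) :=
  SimpleGraph.fromRel fun i j : Fin n =>
    (i.val < k ∧ j.val < k) ∨ i.val + 1 = j.val ∨ (i.val + 1 = n ∧ j.val = 0)

end SimpleGraph

/-- `f_{n,k}(x) = (x-1)_{k-1} ((x-1)^{n-k+1} + (-1)^{n-k})`, where
`(y)_m = y (y - 1) ⋯ (y - m + 1)` is the falling factorial; used for `n ≥ k ≥ 1`. -/
noncomputable def chromaticBound (n k : ℕ) (x : ℤ) : ℤ :=
  (descPochhammer ℤ (k - 1)).eval (x - 1) * ((x - 1) ^ (n - k + 1) + (-1) ^ (n - k))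

/-!
Let `c_j` (`earCount x j`) be the number of colorings of the interior of a path with `j` internal
vertices whose ends have fixed distinct colors. The bound equals `(x)_k * c_{n-k}`, and
`c_{j+1} ≥ (x-2) * c_j`, strictly for `j ≥ 1`. So a graph on `n` vertices containing a `k`-clique
is below the bound as soon as its vertices can be ordered, the clique first, so that the first few
later vertices contribute less than `c_2` or `c_3` and each of the others has two earlier neighbors
that are adjacent to each other, hence contributes at most a factor `x - 2`
(`numColorings_le_pow_mul`).

Since the connectivity is `2`, two vertices `u`, `v` separate `G`. As `α(G) = 2`, what remains
consists of two cliques `A`, `B` with no edges between them, and each of `u`, `v` is complete to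
`A` or to `B`. Hence either `G` is cobipartite, or `u` and `v` are nonadjacent, complete to the
same clique `A` and neither is complete to `B`: an inflated pentagon
(`exists_cobipartite_or_isInflatedPentagon`).

* A cobipartite graph has a clique on `χ(G) = k` vertices, by Hall's theorem
  (`exists_clique_colorable`). Comparing this clique `K` with the two cliques that cover `G` gives
  a good ordering; equality holds only if `K` misses one vertex, of degree `2`, or if
  the complement of `K` is an edge joined to `K` by exactly two disjoint edges. These are
  `G_{k+1,k}` and `G_{k+2,k}` (`numColorings_of_cobipartite`).
* For an inflated pentagon the inequality is always strict (`IsInflatedPentagon.numColorings_lt`).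
  If there is a `k`-clique, `A ∪ {u}` or `B` is one and an ordering as above works. Otherwise
  `k = |B| + 1 = |A| + 2`, and the colorings with `c u = c v` and with `c u ≠ c v` are bounded
  separately, as colorings of the graph with `u`, `v` merged and of the graph with the edge `uv`
  added.
-/

namespace SimpleGraph

/-! ### Counting colorings one vertex at a time -/

section Counting

open scoped Classical
open Finset Function

variable {V : Type*} [Fintype V]

/-- The proper colorings of `G[S]` with the colors of `Fin x`, encoded as functions on all of `V`
that take the value `0` outside `S`. -/
noncomputable def coloringsOn (G : SimpleGraph V) (x : ℕ) [NeZero x] (S : Finset V) :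
    Finset (V → Fin x) :=
  univ.filter fun c => (∀ v, v ∉ S → c v = 0) ∧ ∀ v ∈ S, ∀ w ∈ S, G.Adj v w → c v ≠ c w

/-- The number `P(G[S], x)` of proper colorings of `G[S]`. -/
noncomputable def numOn (G : SimpleGraph V) (x : ℕ) [NeZero x] (S : Finset V) : ℕ :=
  (G.coloringsOn x S).card

variable {G : SimpleGraph V} {x : ℕ} [NeZero x] {S : Finset V}

theorem mem_coloringsOn {c : V → Fin x} : c ∈ G.coloringsOn x S ↔
    (∀ v, v ∉ S → c v = 0) ∧ ∀ v ∈ S, ∀ w ∈ S, G.Adj v w → c v ≠ c w := by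
  simp [coloringsOn]

theorem numColorings_eq_numOn_univ (G : SimpleGraph V) (x : ℕ) [NeZero x] :
    G.numColorings x = G.numOn x univ := by
  rw [numColorings, numOn, ← Nat.card_eq_finsetCard]
  refine Nat.card_congr
    { toFun := fun c => ⟨c, by simpa [mem_coloringsOn] using fun v w h => c.valid h⟩
      invFun := fun c => Coloring.mk c.1 (fun {v w} h =>
        (mem_coloringsOn.1 c.2).2 v (mem_univ _) w (mem_univ _) h)
      left_inv := fun c => rfl
      right_inv := fun c => rfl }

theorem numOn_empty (G : SimpleGraph V) (x : ℕ) [NeZero x] : G.numOn x ∅ = 1 := by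
  rw [numOn, card_eq_one]
  refine ⟨fun _ => 0, ?_⟩
  ext c
  simp [mem_coloringsOn, funext_iff]

theorem update_mem_coloringsOn {c : V → Fin x} {v : V} (hv : v ∉ S)
    (hc : c ∈ G.coloringsOn x (insert v S)) : update c v 0 ∈ G.coloringsOn x S := by
  rw [mem_coloringsOn] at hc ⊢
  refine ⟨fun w hw => ?_, fun w hw z hz h => ?_⟩
  · by_cases hwv : w = v
    · simp [hwv]
    · rw [update_of_ne hwv]; exact hc.1 w (by simp [hwv, hw])
  · have hwv : w ≠ v := ne_of_mem_of_not_mem hw hv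
    have hzv : z ≠ v := ne_of_mem_of_not_mem hz hv
    rw [update_of_ne hwv, update_of_ne hzv]
    exact hc.2 w (mem_insert_of_mem hw) z (mem_insert_of_mem hz) h

/-- A coloring of `G[S]` extends to a further vertex `v` in as many ways as there are colors not
used on the neighbors of `v` in `S`. -/
theorem numOn_insert {v : V} (hv : v ∉ S) : G.numOn x (insert v S) =
    ∑ c ∈ G.coloringsOn x S, (x - (image c (S.filter (G.Adj v))).card) := by
  rw [numOn, card_eq_sum_card_fiberwise (f := fun c => update c v 0)
    (t := G.coloringsOn x S) (fun c hc => update_mem_coloringsOn hv hc)]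
  refine sum_congr rfl fun c hc => ?_
  have hcv : c v = 0 := (mem_coloringsOn.1 hc).1 v hv
  have h1 : x - (image c (S.filter (G.Adj v))).card =
      ((image c (S.filter (G.Adj v)))ᶜ).card := by
    rw [card_compl, Fintype.card_fin]
  rw [h1]
  symm
  refine card_bij (fun i _ => update c v i) (fun i hi => ?_) (fun i _ j _ h => ?_)
    (fun d hd => ?_)
  · simp only [mem_compl, mem_image, mem_filter, not_exists, not_and, and_imp] at hi
    rw [mem_coloringsOn] at hc
    simp only [mem_filter, update_idem, mem_coloringsOn]
    refine ⟨⟨fun w hw => ?_, fun w hw z hz h => ?_⟩, ?_⟩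
    · rw [mem_insert, not_or] at hw
      rw [update_of_ne hw.1]; exact hc.1 w hw.2
    · rcases mem_insert.1 hw with rfl | hw' <;> rcases mem_insert.1 hz with rfl | hz'
      · exact absurd h (G.loopless.irrefl _)
      · rw [update_self, update_of_ne (ne_of_mem_of_not_mem hz' hv)]
        exact fun e => hi z hz' h e.symm
      · rw [update_self, update_of_ne (ne_of_mem_of_not_mem hw' hv)]
        exact fun e => hi w hw' h.symm e
      · rw [update_of_ne (ne_of_mem_of_not_mem hw' hv), update_of_ne (ne_of_mem_of_not_mem hz' hv)]
        exact hc.2 w hw' z hz' h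
    · rw [← hcv, update_eq_self]
  · simpa using congrFun h v
  · simp only [mem_filter] at hd
    obtain ⟨hd, rfl⟩ := hd
    rw [mem_coloringsOn] at hd
    refine ⟨d v, ?_, by simp⟩
    simp only [mem_compl, mem_image, mem_filter, not_exists, not_and, and_imp]
    intro w hw h
    rw [update_of_ne (ne_of_mem_of_not_mem hw hv)]
    exact (hd.2 v (mem_insert_self _ _) w (mem_insert_of_mem hw) h).symm

theorem card_image_clique {c : V → Fin x} (hc : c ∈ G.coloringsOn x S) {T : Finset V}
    (hTS : T ⊆ S) (hT : G.IsClique (T : Set V)) : (image c T).card = T.card := by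
  refine card_image_of_injOn fun a ha b hb h => ?_
  by_contra hab
  exact (mem_coloringsOn.1 hc).2 a (hTS ha) b (hTS hb) (hT ha hb hab) h

/-- Greedy bound: a clique `T` of colored neighbors of `v` excludes `#T` colors for `v`. -/
theorem numOn_insert_le {v : V} (hv : v ∉ S) {T : Finset V} (hTS : T ⊆ S)
    (hT : G.IsClique (T : Set V)) (hvT : ∀ t ∈ T, G.Adj v t) :
    G.numOn x (insert v S) ≤ (x - T.card) * G.numOn x S := by
  rw [numOn_insert hv, numOn, mul_comm, ← smul_eq_mul]
  refine sum_le_card_nsmul _ _ _ fun c hc => ?_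
  rw [← card_image_clique hc hTS hT]
  exact Nat.sub_le_sub_left (card_le_card (image_subset_image fun t ht =>
    mem_filter.2 ⟨hTS ht, hvT t ht⟩)) _

/-- The greedy bound is exact when the colored neighbors of `v` form a clique. -/
theorem numOn_insert_eq {v : V} (hv : v ∉ S) {T : Finset V} (hTS : T ⊆ S)
    (hT : G.IsClique (T : Set V)) (hvT : ∀ t ∈ S, G.Adj v t ↔ t ∈ T) :
    G.numOn x (insert v S) = (x - T.card) * G.numOn x S := by
  have : S.filter (G.Adj v) = T := by
    ext t
    rw [mem_filter]
    exact ⟨fun h => (hvT t h.1).1 h.2, fun h => ⟨hTS h, (hvT t (hTS h)).2 h⟩⟩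
  rw [numOn_insert hv, numOn, mul_comm, ← smul_eq_mul, this]
  exact sum_const_nat fun c hc => by rw [card_image_clique hc hTS hT]

theorem numOn_clique {K : Finset V} (hK : G.IsClique (K : Set V)) :
    G.numOn x K = x.descFactorial K.card := by
  induction K using Finset.induction_on with
  | empty => simp [numOn_empty]
  | insert v S hv ih =>
    have hS : G.IsClique (S : Set V) := hK.subset (by simp)
    rw [numOn_insert_eq hv (Subset.refl S) hS, ih hS, card_insert_of_notMem hv,
      Nat.descFactorial_succ]
    intro t ht
    refine iff_of_true (hK (by simp) (by simp [ht]) ?_) ht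
    rintro rfl; exact hv ht

theorem numOn_insert_le_two {v s t : V} (hv : v ∉ S) (hs : s ∈ S) (ht : t ∈ S)
    (hst : G.Adj s t) (hvs : G.Adj v s) (hvt : G.Adj v t) :
    G.numOn x (insert v S) ≤ (x - 2) * G.numOn x S := by
  rw [← card_pair hst.ne]
  refine numOn_insert_le hv ?_ ?_ ?_
  · simp [insert_subset_iff, hs, ht]
  · simp [hst]
  · simp [hvs, hvt]

theorem numOn_insert_le_one {v s : V} (hv : v ∉ S) (hs : s ∈ S) (hvs : G.Adj v s) :
    G.numOn x (insert v S) ≤ (x - 1) * G.numOn x S := by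
  rw [← card_singleton s]
  exact numOn_insert_le hv (by simpa using hs) (by simp) (by simpa using hvs)

/-- A vertex of `R \ S` with two adjacent neighbors in `S` contributes at most a factor `x - 2`. -/
theorem numOn_le_pow_mul {S R : Finset V} (hSR : S ⊆ R)
    (h : ∀ r ∈ R, r ∉ S → ∃ s ∈ S, ∃ t ∈ S, G.Adj s t ∧ G.Adj r s ∧ G.Adj r t) :
    G.numOn x R ≤ (x - 2) ^ (R.card - S.card) * G.numOn x S := by
  rw [← card_sdiff_of_subset hSR]
  suffices H : ∀ Q ⊆ R \ S, G.numOn x (Q ∪ S) ≤ (x - 2) ^ Q.card * G.numOn x S by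
    simpa [sdiff_union_of_subset hSR] using H _ (Subset.refl _)
  intro Q
  induction Q using Finset.induction_on with
  | empty => simp
  | insert r Q hr ih =>
    intro hQ
    rw [insert_subset_iff, mem_sdiff] at hQ
    obtain ⟨s, hs, t, ht, hst, hrs, hrt⟩ := h r hQ.1.1 hQ.1.2
    rw [insert_union, card_insert_of_notMem hr, pow_succ']
    calc _ ≤ (x - 2) * G.numOn x (Q ∪ S) := numOn_insert_le_two (by simp [hr, hQ.1.2])
            (mem_union_right _ hs) (mem_union_right _ ht) hst hrs hrt
      _ ≤ _ := by rw [mul_assoc]; exact Nat.mul_le_mul_left _ (ih hQ.2)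

/-- A coloring of `S ∪ {p}` with `c p = c v`, where `v ∈ S`, is determined on `S`. -/
theorem card_filter_eq_le {p v : V} (hp : p ∉ S) (hv : v ∈ S) :
    ((G.coloringsOn x (insert p S)).filter fun c => c p = c v).card ≤ G.numOn x S := by
  refine card_le_card_of_injOn (fun c => update c p 0)
    (fun c hc => update_mem_coloringsOn hp (mem_filter.1 hc).1) fun c hc d hd h => ?_
  have hvp : v ≠ p := ne_of_mem_of_not_mem hv hp
  have hoff : ∀ w, w ≠ p → c w = d w := fun w hw => by
    simpa [update_of_ne hw] using congrFun h w
  funext w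
  by_cases hw : w = p
  · rw [hw, (mem_filter.1 hc).2, (mem_filter.1 hd).2, hoff v hvp]
  · exact hoff w hw

/-- If `u` is the only neighbor of `p` in `S` and `v` is adjacent to `u`, then `p` may always repeat
the color of `v`. -/
theorem numOn_le_card_filter_eq {p u v : V} (hp : p ∉ S) (hu : u ∈ S) (hv : v ∈ S)
    (huv : G.Adj u v) (hpS : ∀ t ∈ S, G.Adj p t → t = u) :
    G.numOn x S ≤ ((G.coloringsOn x (insert p S)).filter fun c => c p = c v).card := by
  refine card_le_card_of_injOn (fun c => update c p (c v)) (fun c hc => ?_)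
    fun c hc d hd h => ?_
  · have hc := mem_coloringsOn.1 (Finset.mem_coe.1 hc)
    have hvp : v ≠ p := ne_of_mem_of_not_mem hv hp
    simp only [coe_filter, Set.mem_ofPred_eq, update_self, update_of_ne hvp, and_true,
      mem_coloringsOn]
    refine ⟨fun w hw => ?_, fun w hw z hz h => ?_⟩
    · rw [mem_insert, not_or] at hw
      rw [update_of_ne hw.1]; exact hc.1 w hw.2
    · rcases mem_insert.1 hw with rfl | hw' <;> rcases mem_insert.1 hz with rfl | hz'
      · exact absurd h (G.loopless.irrefl _)
      · rw [update_self, update_of_ne (ne_of_mem_of_not_mem hz' hp), hpS z hz' h]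
        exact (hc.2 u hu v hv huv).symm
      · rw [update_self, update_of_ne (ne_of_mem_of_not_mem hw' hp), hpS w hw' h.symm]
        exact hc.2 u hu v hv huv
      · rw [update_of_ne (ne_of_mem_of_not_mem hw' hp), update_of_ne (ne_of_mem_of_not_mem hz' hp)]
        exact hc.2 w hw' z hz' h
  · funext w
    by_cases hw : w = p
    · rw [hw, (mem_coloringsOn.1 (Finset.mem_coe.1 hc)).1 p hp,
        (mem_coloringsOn.1 (Finset.mem_coe.1 hd)).1 p hp]
    · simpa [update_of_ne hw] using congrFun h w

/-- Two adjacent new vertices `p`, `q` with colored neighbors `u` and `v` respectively contribute at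
most `(x - 1) * (x - 2) + 1`: given `p`, there are at most `x - 2` choices for `q`, and one more if
`p` has the color of `v`. -/
theorem numOn_insert_insert_le {p q u v : V} (hp : p ∉ S) (hq : q ∉ insert p S) (hu : u ∈ S)
    (hv : v ∈ S) (hpq : G.Adj q p) (hpu : G.Adj p u) (hqv : G.Adj q v) :
    G.numOn x (insert q (insert p S)) ≤ ((x - 1) * (x - 2) + 1) * G.numOn x S := by
  have hvp : v ≠ p := ne_of_mem_of_not_mem hv hp
  rw [numOn_insert hq]
  calc _ ≤ ∑ c ∈ G.coloringsOn x (insert p S), ((x - 2) + if c p = c v then 1 else 0) := by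
        refine sum_le_sum fun c _ => ?_
        have h : (image c {p, v}).card ≤ (image c ((insert p S).filter (G.Adj q))).card := by
          refine card_le_card (image_subset_image ?_)
          simp [insert_subset_iff, hpq, hqv, hv]
        rw [image_insert, image_singleton] at h
        split_ifs with hc
        · rw [hc, pair_eq_singleton, card_singleton] at h; omega
        · rw [card_pair hc] at h; omega
    _ = G.numOn x (insert p S) * (x - 2) +
          ((G.coloringsOn x (insert p S)).filter fun c => c p = c v).card := by
        rw [sum_add_distrib, sum_const, card_filter, smul_eq_mul, numOn]
    _ ≤ ((x - 1) * G.numOn x S) * (x - 2) + G.numOn x S :=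
        Nat.add_le_add (Nat.mul_le_mul_right _ (numOn_insert_le_one hp hu hpu))
          (card_filter_eq_le hp hv)
    _ = _ := by ring

/-- Equality in `numOn_insert_insert_le` if `u`, `v` are adjacent and there are no further edges. -/
theorem numOn_insert_insert_eq {p q u v : V} (hx : 2 ≤ x) (hp : p ∉ S) (hq : q ∉ insert p S)
    (hu : u ∈ S) (hv : v ∈ S) (huv : G.Adj u v) (hpS : ∀ t ∈ S, G.Adj p t ↔ t = u)
    (hqS : ∀ t ∈ insert p S, G.Adj q t ↔ t = p ∨ t = v) :
    G.numOn x (insert q (insert p S)) = ((x - 1) * (x - 2) + 1) * G.numOn x S := by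
  have hvp : v ≠ p := ne_of_mem_of_not_mem hv hp
  have hN : (insert p S).filter (G.Adj q) = {p, v} := by
    ext t
    simp only [mem_filter, mem_insert (s := {v}), mem_singleton]
    refine ⟨fun h => (hqS t h.1).1 h.2, fun h => ?_⟩
    have ht : t ∈ insert p S := by rcases h with rfl | rfl <;> simp [hv]
    exact ⟨ht, (hqS t ht).2 h⟩
  rw [numOn_insert hq, hN]
  calc _ = ∑ c ∈ G.coloringsOn x (insert p S), ((x - 2) + if c p = c v then 1 else 0) := by
        refine sum_congr rfl fun c _ => ?_
        rw [image_insert, image_singleton]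
        split_ifs with hc
        · rw [hc, pair_eq_singleton, card_singleton]; omega
        · rw [card_pair hc]; rfl
    _ = G.numOn x (insert p S) * (x - 2) +
          ((G.coloringsOn x (insert p S)).filter fun c => c p = c v).card := by
        rw [sum_add_distrib, sum_const, card_filter, smul_eq_mul, numOn]
    _ = ((x - 1) * G.numOn x S) * (x - 2) + G.numOn x S := by
        rw [le_antisymm (card_filter_eq_le hp hv)
            (numOn_le_card_filter_eq hp hu hv huv fun t ht => (hpS t ht).1),
          numOn_insert_eq (T := {u}) hp (by simpa using hu) (by simp) (by simpa using hpS),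
          card_singleton]
    _ = _ := by ring

end Counting

/-! ### Colorings of a path with fixed ends -/

section EarCount

/-- The number of ways to color the `j` internal vertices of a path with `x` colors when its two
ends carry fixed distinct colors. In the recurrence the first internal vertex either avoids both end
colors or repeats the color of the far end; the next internal vertex then has `x - 1` choices, each
different from that of the far end. -/
def earCount (x : ℕ) : ℕ → ℕ
  | 0 => 1
  | 1 => x - 2
  | j + 2 => (x - 2) * earCount x (j + 1) + (x - 1) * earCount x j

/-- The closed form of `earCount`, in a form without division. -/
theorem mul_earCount {x : ℕ} (hx : 2 ≤ x) (j : ℕ) :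
    (x : ℤ) * earCount x j = (x - 1) ^ (j + 1) + (-1) ^ j := by
  obtain ⟨y, rfl⟩ := Nat.exists_eq_add_of_le' hx
  induction j using Nat.twoStepInduction with
  | zero => simp [earCount]
  | one => simp [earCount]; ring
  | more j ih1 ih2 =>
    have h1 : y + 2 - 1 = y + 1 := rfl
    simp only [earCount, Nat.add_sub_cancel, h1]
    push_cast at ih1 ih2 ⊢
    rw [mul_add, mul_left_comm, ih2, mul_left_comm, ih1]
    ring

/-- The bound counts the colorings of a `k`-clique with an ear of `n - k` internal vertices. -/
theorem chromaticBound_eq {n k x : ℕ} (hk : 1 ≤ k) (hx : 2 ≤ x) :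
    chromaticBound n k (x : ℤ) = ((x.descFactorial k * earCount x (n - k) : ℕ) : ℤ) := by
  obtain ⟨y, rfl⟩ := Nat.exists_eq_add_of_le' hx
  obtain ⟨k, rfl⟩ := Nat.exists_eq_add_of_le' hk
  have h := mul_earCount hx (n - (k + 1))
  have h1 : (((y + 2 : ℕ) : ℤ) - 1) = ((y + 1 : ℕ) : ℤ) := by push_cast; ring
  rw [chromaticBound, Nat.add_sub_cancel, ← h, h1, descPochhammer_eval_eq_descFactorial,
    Nat.succ_descFactorial_succ]
  push_cast
  ring

variable {x : ℕ}

theorem earCount_two (hx : 2 ≤ x) : earCount x 2 = (x - 1) * (x - 2) + 1 := by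
  obtain ⟨y, rfl⟩ := Nat.exists_eq_add_of_le' hx
  have h1 : y + 2 - 1 = y + 1 := rfl
  simp only [earCount, Nat.add_sub_cancel, h1]
  ring

theorem earCount_three (hx : 2 ≤ x) : earCount x 3 = (x - 2) * ((x - 1) ^ 2 + 1) := by
  obtain ⟨y, rfl⟩ := Nat.exists_eq_add_of_le' hx
  have h1 : y + 2 - 1 = y + 1 := rfl
  simp only [earCount, Nat.add_sub_cancel, h1]
  ring

theorem earCount_pos (hx : 3 ≤ x) (j : ℕ) : 0 < earCount x j := by
  induction j using Nat.twoStepInduction with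
  | zero => simp [earCount]
  | one => simp [earCount]; omega
  | more j ih1 ih2 =>
    have : 0 < x - 2 := by omega
    simp only [earCount]
    positivity

theorem mul_earCount_lt (hx : 3 ≤ x) (j : ℕ) :
    (x - 2) * earCount x (j + 1) < earCount x (j + 2) := by
  have h := earCount_pos hx j
  have : 0 < x - 1 := by omega
  simp only [earCount]
  have := Nat.mul_pos this h
  omega

theorem pow_mul_earCount_le (hx : 3 ≤ x) (i j : ℕ) :
    (x - 2) ^ i * earCount x (j + 1) ≤ earCount x (i + j + 1) := by
  induction i with
  | zero => simp
  | succ i ih =>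
    calc _ = (x - 2) * ((x - 2) ^ i * earCount x (j + 1)) := by ring
      _ ≤ (x - 2) * earCount x (i + j + 1) := Nat.mul_le_mul_left _ ih
      _ ≤ earCount x (i + j + 2) := (mul_earCount_lt hx _).le
      _ = _ := by congr 1; omega

theorem pow_mul_earCount_lt (hx : 3 ≤ x) {i : ℕ} (hi : 0 < i) (j : ℕ) :
    (x - 2) ^ i * earCount x (j + 1) < earCount x (i + j + 1) := by
  obtain ⟨i, rfl⟩ := Nat.exists_eq_add_of_le' hi
  calc _ = (x - 2) * ((x - 2) ^ i * earCount x (j + 1)) := by ring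
    _ ≤ (x - 2) * earCount x (i + j + 1) := Nat.mul_le_mul_left _ (pow_mul_earCount_le hx i j)
    _ < earCount x (i + j + 2) := mul_earCount_lt hx _
    _ = _ := by congr 1; omega

theorem pow_lt_earCount (hx : 3 ≤ x) {j : ℕ} (hj : 2 ≤ j) : (x - 2) ^ j < earCount x j := by
  obtain ⟨j, rfl⟩ := Nat.exists_eq_add_of_le' hj
  have h := pow_mul_earCount_lt hx (i := j + 1) (by omega) 0
  simpa [earCount, pow_succ] using h

/-- A quadratic factor below `earCount x 2`, completed by factors `x - 2`. -/
theorem pow_mul_lt_earCount_of_lt_two (hx : 3 ≤ x) {j m : ℕ} (hj : 2 ≤ j)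
    (hm : m < earCount x 2) : (x - 2) ^ (j - 2) * m < earCount x j := by
  obtain ⟨j, rfl⟩ := Nat.exists_eq_add_of_le' hj
  have : 0 < (x - 2) ^ j := pow_pos (by omega) _
  calc _ < (x - 2) ^ j * earCount x 2 := Nat.mul_lt_mul_of_pos_left hm this
    _ ≤ _ := pow_mul_earCount_le hx j 1

/-- A cubic factor below `earCount x 3`, completed by factors `x - 2`. -/
theorem pow_mul_lt_earCount_of_lt_three (hx : 3 ≤ x) {j m : ℕ} (hj : 3 ≤ j)
    (hm : m < earCount x 3) : (x - 2) ^ (j - 3) * m < earCount x j := by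
  obtain ⟨j, rfl⟩ := Nat.exists_eq_add_of_le' hj
  have : 0 < (x - 2) ^ j := pow_pos (by omega) _
  calc _ < (x - 2) ^ j * earCount x 3 := Nat.mul_lt_mul_of_pos_left hm this
    _ ≤ _ := pow_mul_earCount_le hx j 2

theorem sub_one_mul_sub_three_lt (hx : 3 ≤ x) : (x - 1) * (x - 3) < earCount x 2 := by
  rw [earCount_two (by omega)]
  have := Nat.mul_le_mul_left (x - 1) (show x - 3 ≤ x - 2 by omega)
  omega

theorem sub_one_sq_mul_sub_three_lt (hx : 3 ≤ x) :
    (x - 3) * ((x - 1) * (x - 1)) < earCount x 3 := by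
  rw [earCount_three (by omega)]
  obtain ⟨y, rfl⟩ := Nat.exists_eq_add_of_le' hx
  have h1 : y + 3 - 1 = y + 2 := rfl
  have h2 : y + 3 - 2 = y + 1 := rfl
  rw [h1, h2, Nat.add_sub_cancel]
  nlinarith

end EarCount

/-! ### Cliques with an ear -/

section CliqueWithEar

open scoped Classical
open Finset

variable {V : Type*} {G : SimpleGraph V}

theorem cliqueWithEar_adj {n k : ℕ} {i j : Fin n} : (cliqueWithEar n k).Adj i j ↔
    i.val ≠ j.val ∧ ((i.val < k ∧ j.val < k) ∨ i.val + 1 = j.val ∨ j.val + 1 = i.val ∨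
      (i.val + 1 = n ∧ j.val = 0) ∨ (j.val + 1 = n ∧ i.val = 0)) := by
  rw [cliqueWithEar, fromRel_adj, Ne, Fin.ext_iff]
  tauto

theorem numColorings_congr {W : Type*} {H : SimpleGraph W} (e : G ≃g H) (x : ℕ) :
    G.numColorings x = H.numColorings x :=
  Nat.card_congr
    { toFun := fun c => c.comp e.symm.toHom
      invFun := fun c => c.comp e.toHom
      left_inv := fun c => by ext v; simp
      right_inv := fun c => by ext v; simp }

/-- A numbering of the vertices that carries adjacency to `cliqueWithEar` is an isomorphism. -/
theorem nonempty_iso_cliqueWithEar [Fintype V] {n k : ℕ} (hn : Fintype.card V = n) (F : V → ℕ)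
    (hF : Function.Injective F) (hFn : ∀ v, F v < n)
    (hadj : ∀ v w, G.Adj v w ↔ F v ≠ F w ∧ ((F v < k ∧ F w < k) ∨ F v + 1 = F w ∨
      F w + 1 = F v ∨ (F v + 1 = n ∧ F w = 0) ∨ (F w + 1 = n ∧ F v = 0))) :
    Nonempty (G ≃g cliqueWithEar n k) := by
  have hinj : Function.Injective fun v => (⟨F v, hFn v⟩ : Fin n) := fun v w h =>
    hF (Fin.ext_iff.1 h)
  have hbij := (Fintype.bijective_iff_injective_and_card _).2
    ⟨hinj, by rw [hn, Fintype.card_fin]⟩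
  exact ⟨⟨Equiv.ofBijective _ hbij, fun {v w} => by
    rw [cliqueWithEar_adj, hadj]; rfl⟩⟩

/-- A clique can be numbered by `0, …, k - 1` so that two chosen vertices become the attachment
points `k - 1` and `0` of the ear. -/
theorem exists_numbering {k : ℕ} (hk : 2 ≤ k) {K : Finset V} (hK : K.card = k) {y z : V}
    (hy : y ∈ K) (hz : z ∈ K) (hyz : y ≠ z) :
    ∃ f : V → ℕ, (∀ v ∈ K, ∀ w ∈ K, f v = f w → v = w) ∧ (∀ w ∈ K, f w < k) ∧
      f y = k - 1 ∧ f z = 0 := by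
  have e := K.equivFinOfCardEq hK
  let e₁ := e.trans (Equiv.swap (e ⟨z, hz⟩) ⟨0, by omega⟩)
  let e₂ := e₁.trans (Equiv.swap (e₁ ⟨y, hy⟩) ⟨k - 1, by omega⟩)
  have hz₁ : e₁ ⟨z, hz⟩ = ⟨0, by omega⟩ := by simp [e₁]
  have hz₂ : e₂ ⟨z, hz⟩ = ⟨0, by omega⟩ := by
    rw [Equiv.trans_apply, hz₁, Equiv.swap_apply_of_ne_of_ne]
    · rw [← hz₁]
      exact fun h => hyz (congrArg Subtype.val (e₁.injective h)).symm
    · rw [Ne, Fin.ext_iff]; simp; omega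
  have hy₂ : e₂ ⟨y, hy⟩ = ⟨k - 1, by omega⟩ := by simp [e₂]
  refine ⟨fun v => if h : v ∈ K then e₂ ⟨v, h⟩ else 0, fun v hv w hw h => ?_, fun w hw => ?_,
    ?_, ?_⟩
  · simp only [hv, hw, dif_pos] at h
    exact congrArg Subtype.val (e₂.injective (Fin.ext h))
  · simp only [hw, dif_pos]; exact (e₂ _).2
  · simp only [hy, dif_pos, hy₂]
  · simp only [hz, dif_pos, hz₂]

theorem nonempty_iso_of_ear_one [Fintype V] {k : ℕ} (hk : 2 ≤ k) {K : Finset V}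
    (hKc : G.IsClique (K : Set V))
    (hK : K.card = k) {p y z : V} (hp : p ∉ K) (hV : ∀ v, v = p ∨ v ∈ K) (hy : y ∈ K)
    (hz : z ∈ K) (hyz : y ≠ z) (hpK : ∀ t ∈ K, G.Adj p t ↔ t = y ∨ t = z) :
    Nonempty (G ≃g cliqueWithEar (k + 1) k) := by
  obtain ⟨f, hfi, hfk, hfy, hfz⟩ := exists_numbering hk hK hy hz hyz
  have hn : Fintype.card V = k + 1 := by
    rw [← hK, ← card_insert_of_notMem hp, ← card_univ]
    congr 1; ext v; simpa using hV v
  obtain ⟨F, hFp, hFK⟩ : ∃ F : V → ℕ, F p = k ∧ ∀ v ∈ K, F v = f v :=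
    ⟨fun v => if v ∈ K then f v else k, if_neg hp, fun v hv => if_pos hv⟩
  have hpt : ∀ t ∈ K, G.Adj p t ↔ f t = k - 1 ∨ f t = 0 := fun t ht => by
    rw [hpK t ht]
    refine or_congr ⟨fun h => h ▸ hfy, fun h => hfi t ht y hy (h.trans hfy.symm)⟩
      ⟨fun h => h ▸ hfz, fun h => hfi t ht z hz (h.trans hfz.symm)⟩
  refine nonempty_iso_cliqueWithEar hn F (fun v w h => ?_) (fun v => ?_) (fun v w => ?_)
  · rcases hV v with rfl | hv <;> rcases hV w with rfl | hw
    · rfl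
    · have := hfk w hw; rw [hFK w hw] at h; omega
    · have := hfk v hv; rw [hFK v hv] at h; omega
    · rw [hFK v hv, hFK w hw] at h
      exact hfi v hv w hw h
  · rcases hV v with rfl | hv
    · omega
    · have := hfk v hv; rw [hFK v hv]; omega
  · rcases hV v with rfl | hv <;> rcases hV w with rfl | hw
    · simp
    · rw [hFp, hFK w hw, hpt w hw]
      have := hfk w hw
      omega
    · rw [hFp, hFK v hv, G.adj_comm v, hpt v hv]
      have := hfk v hv
      omega
    · rw [hFK v hv, hFK w hw]
      have h1 := hfk v hv
      have h2 := hfk w hw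
      refine ⟨fun h => ⟨fun e => h.ne (hfi v hv w hw e), Or.inl ⟨h1, h2⟩⟩, fun h =>
        hKc hv hw fun e => h.1 (e ▸ rfl)⟩

theorem numColorings_of_ear_one [Fintype V] {x : ℕ} [NeZero x] {K : Finset V}
    (hKc : G.IsClique (K : Set V))
    {p y z : V} (hp : p ∉ K) (hV : ∀ v, v = p ∨ v ∈ K) (hy : y ∈ K)
    (hz : z ∈ K) (hyz : y ≠ z) (hpK : ∀ t ∈ K, G.Adj p t ↔ t = y ∨ t = z) :
    G.numColorings x = x.descFactorial K.card * earCount x 1 := by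
  have huniv : (univ : Finset V) = insert p K := by ext v; simpa using hV v
  rw [numColorings_eq_numOn_univ, huniv, numOn_insert_eq (T := {y, z}) hp,
    numOn_clique hKc, card_pair hyz, earCount, mul_comm]
  · simp [insert_subset_iff, hy, hz]
  · simpa [hyz] using hKc hy hz hyz
  · simpa using hpK

theorem nonempty_iso_of_ear_two [Fintype V] {k : ℕ} (hk : 2 ≤ k) {K : Finset V}
    (hKc : G.IsClique (K : Set V))
    (hK : K.card = k) {p q y z : V} (hp : p ∉ K) (hq : q ∉ K) (hqp : q ≠ p)
    (hV : ∀ v, v = q ∨ v = p ∨ v ∈ K) (hy : y ∈ K) (hz : z ∈ K) (hyz : y ≠ z)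
    (hpq : G.Adj p q) (hpK : ∀ t ∈ K, G.Adj p t ↔ t = y) (hqK : ∀ t ∈ K, G.Adj q t ↔ t = z) :
    Nonempty (G ≃g cliqueWithEar (k + 2) k) := by
  obtain ⟨f, hfi, hfk, hfy, hfz⟩ := exists_numbering hk hK hy hz hyz
  have hn : Fintype.card V = k + 2 := by
    rw [← hK, show K.card + 2 = K.card + 1 + 1 from rfl, ← card_insert_of_notMem hp,
      ← card_insert_of_notMem (s := insert p K) (a := q) (by simp [hq, hqp]), ← card_univ]
    congr 1; ext v; simpa using hV v
  obtain ⟨F, hFp, hFq, hFK⟩ : ∃ F : V → ℕ, F p = k ∧ F q = k + 1 ∧ ∀ v ∈ K, F v = f v :=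
    ⟨fun v => if v ∈ K then f v else if v = p then k else k + 1, by simp [hp],
      by simp [hq, hqp], fun v hv => if_pos hv⟩
  have hpt : ∀ t ∈ K, G.Adj p t ↔ f t = k - 1 := fun t ht => by
    rw [hpK t ht]
    exact ⟨fun h => h ▸ hfy, fun h => hfi t ht y hy (h.trans hfy.symm)⟩
  have hqt : ∀ t ∈ K, G.Adj q t ↔ f t = 0 := fun t ht => by
    rw [hqK t ht]
    exact ⟨fun h => h ▸ hfz, fun h => hfi t ht z hz (h.trans hfz.symm)⟩
  refine nonempty_iso_cliqueWithEar hn F (fun v w h => ?_) (fun v => ?_) (fun v w => ?_)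
  · rcases hV v with rfl | rfl | hv <;> rcases hV w with rfl | rfl | hw
    · rfl
    · omega
    · have := hfk w hw; rw [hFK w hw] at h; omega
    · omega
    · rfl
    · have := hfk w hw; rw [hFK w hw] at h; omega
    · have := hfk v hv; rw [hFK v hv] at h; omega
    · have := hfk v hv; rw [hFK v hv] at h; omega
    · rw [hFK v hv, hFK w hw] at h
      exact hfi v hv w hw h
  · rcases hV v with rfl | rfl | hv
    · omega
    · omega
    · have := hfk v hv; rw [hFK v hv]; omega
  · rcases hV v with rfl | rfl | hv <;> rcases hV w with rfl | rfl | hw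
    · simp
    · refine iff_of_true hpq.symm ?_; omega
    · rw [hFq, hFK w hw, hqt w hw]
      have := hfk w hw
      omega
    · refine iff_of_true hpq ?_; omega
    · simp
    · rw [hFp, hFK w hw, hpt w hw]
      have := hfk w hw
      omega
    · rw [hFq, hFK v hv, G.adj_comm v, hqt v hv]
      have := hfk v hv
      omega
    · rw [hFp, hFK v hv, G.adj_comm v, hpt v hv]
      have := hfk v hv
      omega
    · rw [hFK v hv, hFK w hw]
      have h1 := hfk v hv
      have h2 := hfk w hw
      refine ⟨fun h => ⟨fun e => h.ne (hfi v hv w hw e), Or.inl ⟨h1, h2⟩⟩, fun h =>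
        hKc hv hw fun e => h.1 (e ▸ rfl)⟩

theorem numColorings_of_ear_two [Fintype V] {x : ℕ} [NeZero x] (hx : 2 ≤ x) {K : Finset V}
    (hKc : G.IsClique (K : Set V)) {p q y z : V} (hp : p ∉ K) (hq : q ∉ K) (hqp : q ≠ p)
    (hV : ∀ v, v = q ∨ v = p ∨ v ∈ K) (hy : y ∈ K) (hz : z ∈ K) (hyz : y ≠ z)
    (hpq : G.Adj p q) (hpK : ∀ t ∈ K, G.Adj p t ↔ t = y) (hqK : ∀ t ∈ K, G.Adj q t ↔ t = z) :
    G.numColorings x = x.descFactorial K.card * earCount x 2 := by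
  have huniv : (univ : Finset V) = insert q (insert p K) := by ext v; simpa using hV v
  rw [numColorings_eq_numOn_univ, huniv, numOn_insert_insert_eq hx hp (by simp [hq, hqp]) hy hz
    (hKc hy hz hyz) hpK, numOn_clique hKc, earCount_two hx, mul_comm]
  intro t ht
  rcases mem_insert.1 ht with rfl | ht
  · simp [hpq.symm]
  · rw [hqK t ht]
    exact ⟨Or.inr, fun h => h.resolve_left (ne_of_mem_of_not_mem ht hp)⟩

theorem card_filter_val_lt {n k : ℕ} (h : k ≤ n) :
    (univ.filter fun i : Fin n => i.val < k).card = k := by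
  rw [Fin.card_filter_val_lt, min_eq_right h]

theorem isClique_cliqueWithEar (n k : ℕ) :
    (cliqueWithEar n k).IsClique ((univ.filter fun i : Fin n => i.val < k : Finset (Fin n)) :
      Set (Fin n)) := by
  intro i hi j hj hij
  simp only [coe_filter, mem_univ, true_and, Set.mem_ofPred_eq] at hi hj
  exact cliqueWithEar_adj.2 ⟨fun h => hij (Fin.ext h), Or.inl ⟨hi, hj⟩⟩

theorem numColorings_cliqueWithEar_one {k x : ℕ} [NeZero x] (hk : 2 ≤ k) :
    (cliqueWithEar (k + 1) k).numColorings x = x.descFactorial k * earCount x 1 := by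
  have hcard := card_filter_val_lt (Nat.le_succ k)
  have hcl := isClique_cliqueWithEar (k + 1) k
  set K : Finset (Fin (k + 1)) := univ.filter fun i => i.val < k with hKdef
  have hmem : ∀ i, i ∈ K ↔ i.val < k := fun i => by simp [hKdef]
  obtain ⟨p, hp⟩ : ∃ p : Fin (k + 1), p.val = k := ⟨⟨k, by omega⟩, rfl⟩
  obtain ⟨y, hy⟩ : ∃ y : Fin (k + 1), y.val = k - 1 := ⟨⟨k - 1, by omega⟩, rfl⟩
  obtain ⟨z, hz⟩ : ∃ z : Fin (k + 1), z.val = 0 := ⟨⟨0, by omega⟩, rfl⟩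
  have hyz : y ≠ z := by rw [Ne, Fin.ext_iff]; omega
  rw [numColorings_of_ear_one hcl (p := p) (y := y) (z := z) ?_ ?_ ?_ ?_ hyz ?_, hcard]
  · rw [hmem]; omega
  · intro v; rw [hmem, Fin.ext_iff]; omega
  · rw [hmem]; omega
  · rw [hmem]; omega
  · intro t ht
    rw [hmem] at ht
    rw [cliqueWithEar_adj, Fin.ext_iff, Fin.ext_iff]
    omega

theorem numColorings_cliqueWithEar_two {k x : ℕ} [NeZero x] (hk : 2 ≤ k) (hx : 2 ≤ x) :
    (cliqueWithEar (k + 2) k).numColorings x = x.descFactorial k * earCount x 2 := by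
  have hcard := card_filter_val_lt (show k ≤ k + 2 by omega)
  have hcl := isClique_cliqueWithEar (k + 2) k
  set K : Finset (Fin (k + 2)) := univ.filter fun i => i.val < k with hKdef
  have hmem : ∀ i, i ∈ K ↔ i.val < k := fun i => by simp [hKdef]
  obtain ⟨p, hp⟩ : ∃ p : Fin (k + 2), p.val = k := ⟨⟨k, by omega⟩, rfl⟩
  obtain ⟨q, hq⟩ : ∃ q : Fin (k + 2), q.val = k + 1 := ⟨⟨k + 1, by omega⟩, rfl⟩
  obtain ⟨y, hy⟩ : ∃ y : Fin (k + 2), y.val = k - 1 := ⟨⟨k - 1, by omega⟩, rfl⟩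
  obtain ⟨z, hz⟩ : ∃ z : Fin (k + 2), z.val = 0 := ⟨⟨0, by omega⟩, rfl⟩
  have hyz : y ≠ z := by rw [Ne, Fin.ext_iff]; omega
  rw [numColorings_of_ear_two hx hcl (p := p) (q := q) (y := y) (z := z) ?_ ?_ ?_ ?_ ?_ ?_ hyz
    ?_ ?_ ?_, hcard]
  · rw [hmem]; omega
  · rw [hmem]; omega
  · rw [Ne, Fin.ext_iff]; omega
  · intro v; rw [hmem, Fin.ext_iff, Fin.ext_iff]; omega
  · rw [hmem]; omega
  · rw [hmem]; omega
  · rw [cliqueWithEar_adj]; omega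
  · intro t ht
    rw [hmem] at ht
    rw [cliqueWithEar_adj, Fin.ext_iff]
    omega
  · intro t ht
    rw [hmem] at ht
    rw [cliqueWithEar_adj, Fin.ext_iff]
    omega

end CliqueWithEar

/-! ### Connectivity, cobipartite graphs and the two possible shapes -/

section Structure

open scoped Classical
open Finset

variable {V : Type*} {G : SimpleGraph V}

theorem isClique_insert_of_forall {K : Finset V} {v : V} (hK : G.IsClique (K : Set V))
    (h : ∀ w ∈ K, G.Adj v w) : G.IsClique ((insert v K : Finset V) : Set V) := by
  rw [coe_insert]
  exact hK.insert fun w hw _ => h w hw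

theorem colorable_of_forall_mem {W : Type*} {T : Finset W} {c : V → W} (hc : ∀ v, c v ∈ T)
    (h : ∀ {v w}, G.Adj v w → c v ≠ c w) : G.Colorable T.card := by
  have C : G.Coloring T := Coloring.mk (fun v => ⟨c v, hc v⟩) fun hvw e =>
    h hvw (congrArg Subtype.val e)
  simpa using C.colorable

/-- `A` and `B` are disjoint cliques without edges between them, and together with the nonadjacent
vertices `u` and `v` they cover the graph. Both `u` and `v` are complete to the nonempty set `A`,
neither is complete to `B`, and every vertex of `B` is adjacent to `u` or `v`. If `u` and `v` have
no common neighbor in `B`, this is a pentagon three of whose vertices are replaced by cliques. -/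
structure IsInflatedPentagon (G : SimpleGraph V) (A B : Finset V) (u v : V) : Prop where
  isClique_left : G.IsClique (A : Set V)
  isClique_right : G.IsClique (B : Set V)
  nonempty : A.Nonempty
  disjoint : Disjoint A B
  ne : u ≠ v
  mem_iff : ∀ w, w ∈ A ∨ w ∈ B ↔ w ≠ u ∧ w ≠ v
  not_adj : ∀ a ∈ A, ∀ b ∈ B, ¬ G.Adj a b
  not_adj_ends : ¬ G.Adj u v
  adj_left : ∀ a ∈ A, G.Adj u a ∧ G.Adj v a
  adj_right : ∀ b ∈ B, G.Adj u b ∨ G.Adj v b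
  exists_not_adj_fst : ∃ b ∈ B, ¬ G.Adj u b
  exists_not_adj_snd : ∃ b ∈ B, ¬ G.Adj v b

variable [Fintype V]

/-- After deleting `z` from a `2`-connected graph there is still an edge leaving `C`. -/
theorem IsVertexConnected.exists_adj (h : G.IsVertexConnected 2) (z : V) {C : Finset V}
    {a b : V} (ha : a ∈ C) (haz : a ≠ z) (hb : b ∉ C) (hbz : b ≠ z) :
    ∃ p ∈ C, p ≠ z ∧ ∃ y, y ∉ C ∧ y ≠ z ∧ G.Adj p y := by
  have hc := h.2 {z} (by simp)
  obtain ⟨w⟩ := hc.preconnected ⟨a, by simpa using haz⟩ ⟨b, by simpa using hbz⟩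
  obtain ⟨d, -, hd1, hd2⟩ := w.exists_boundary_dart {v | v.1 ∈ C} ha hb
  refine ⟨d.fst.1, hd1, by simpa using d.fst.2, d.snd.1, hd2, by simpa using d.snd.2, d.adj⟩

/-- In a `2`-connected graph, two disjoint edges join any two complementary sets of at least two
vertices. -/
theorem IsVertexConnected.exists_disjoint_adj (h : G.IsVertexConnected 2) {C : Finset V}
    (hC : 1 < C.card) (hC' : 1 < Cᶜ.card) :
    ∃ p ∈ C, ∃ q ∈ C, p ≠ q ∧ ∃ y, y ∉ C ∧ ∃ z, z ∉ C ∧ y ≠ z ∧ G.Adj p y ∧ G.Adj q z := by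
  obtain ⟨a₀, ha₀⟩ : C.Nonempty := card_pos.1 (by omega)
  have key : ∀ z, z ∉ C → ∃ p ∈ C, ∃ y, y ∉ C ∧ y ≠ z ∧ G.Adj p y := fun z hz => by
    obtain ⟨b, hb, hbz⟩ := exists_mem_ne hC' z
    obtain ⟨p, hp, -, y, hy, hyz, hpy⟩ := h.exists_adj z ha₀ (ne_of_mem_of_not_mem ha₀ hz)
      (mem_compl.1 hb) hbz
    exact ⟨p, hp, y, hy, hyz, hpy⟩
  obtain ⟨b₀, hb₀⟩ : Cᶜ.Nonempty := card_pos.1 (by omega)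
  -- an edge `p₁ y₁`, then one avoiding `y₁`; if both start at `p₁`, a third one avoiding `p₁`
  obtain ⟨p₁, hp₁, y₁, hy₁, -, h₁⟩ := key b₀ (mem_compl.1 hb₀)
  obtain ⟨p₂, hp₂, y₂, hy₂, hne, h₂⟩ := key y₁ hy₁
  by_cases hp : p₁ = p₂
  · subst hp
    obtain ⟨a, ha, hap⟩ := exists_mem_ne hC p₁
    obtain ⟨q, hq, hqp, z, hz, -, hqz⟩ := h.exists_adj p₁ ha hap hy₁
      (ne_of_mem_of_not_mem hp₁ hy₁).symm
    by_cases hzy : z = y₁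
    · exact ⟨p₁, hp₁, q, hq, hqp.symm, y₂, hy₂, z, hz, hzy ▸ hne, h₂, hqz⟩
    · exact ⟨p₁, hp₁, q, hq, hqp.symm, y₁, hy₁, z, hz, Ne.symm hzy, h₁, hqz⟩
  · exact ⟨p₁, hp₁, p₂, hp₂, hp, y₁, hy₁, y₂, hy₂, hne.symm, h₁, h₂⟩

/-- Cobipartite graphs are weakly perfect. -/
theorem exists_clique_colorable {Y : Finset V} (hY : G.IsClique (Y : Set V))
    (hX : G.IsClique ((Yᶜ : Finset V) : Set V)) :
    ∃ K : Finset V, G.IsClique (K : Set V) ∧ G.Colorable K.card := by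
  -- `N s` is the set of vertices of `Y` that miss some vertex of `s`
  let N : Finset V → Finset V := fun s => Y.filter fun y => ∃ v ∈ s, ¬ G.Adj v y
  obtain ⟨S, hS, hmax⟩ := exists_max_image (Yᶜ).powerset
    (fun s => s.card + (Y \ N s).card) ⟨∅, by simp⟩
  rw [mem_powerset] at hS
  have hdisj : Disjoint S (Y \ N S) := by
    rw [Finset.disjoint_left]
    exact fun v hv hv' => mem_compl.1 (hS hv) (mem_sdiff.1 hv').1
  refine ⟨S ∪ (Y \ N S), ?_, ?_⟩
  · have hcross : ∀ v ∈ S, ∀ y ∈ Y \ N S, G.Adj v y := fun v hv y hy => by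
      by_contra hvy
      rw [mem_sdiff] at hy
      exact hy.2 (mem_filter.2 ⟨hy.1, v, hv, hvy⟩)
    intro v hv w hw hvw
    rw [mem_coe, mem_union] at hv hw
    rcases hv with hv | hv <;> rcases hw with hw | hw
    · exact hX (mem_coe.2 (hS hv)) (mem_coe.2 (hS hw)) hvw
    · exact hcross v hv w hw
    · exact (hcross w hw v hv).symm
    · exact hY (mem_coe.2 (mem_sdiff.1 hv).1) (mem_coe.2 (mem_sdiff.1 hw).1) hvw
  · rw [card_union_of_disjoint hdisj]
    have hm : Y.card ≤ S.card + (Y \ N S).card := by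
      have := hmax ∅ (by simp)
      simpa [N] using this
    obtain ⟨d, hd⟩ := Nat.exists_eq_add_of_le hm
    -- Hall's condition holds once `d` spare colors are available to every vertex outside `Y`
    let t : {v // v ∉ Y} → Finset (V ⊕ Fin d) := fun v =>
      (N {v.1}).disjSum univ
    have hall : ∀ s : Finset {v // v ∉ Y}, s.card ≤ (s.biUnion t).card := fun s => by
      rcases s.eq_empty_or_nonempty with rfl | hne
      · simp
      have hst : s.biUnion t = (N (s.map (Function.Embedding.subtype _))).disjSum univ := by
        obtain ⟨v₀, hv₀⟩ := hne
        ext (y | i)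
        · simp only [t, N, mem_biUnion, inl_mem_disjSum, mem_filter, mem_singleton,
            exists_eq_left, mem_map, Function.Embedding.subtype_apply]
          constructor
          · rintro ⟨v, hv, hy, h⟩
            exact ⟨hy, v.1, ⟨v, hv, rfl⟩, h⟩
          · rintro ⟨hy, _, ⟨v, hv, rfl⟩, h⟩
            exact ⟨v, hv, hy, h⟩
        · simp only [t, mem_biUnion, inr_mem_disjSum, mem_univ, and_true, iff_true]
          exact ⟨v₀, hv₀⟩
      have h1 := hmax (s.map (Function.Embedding.subtype _)) (by
        rw [mem_powerset]
        intro v hv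
        obtain ⟨w, -, rfl⟩ := mem_map.1 hv
        exact mem_compl.2 w.2)
      have hNY : N (s.map (Function.Embedding.subtype _)) ⊆ Y := filter_subset _ _
      have h2 := card_sdiff_add_card_eq_card hNY
      rw [hst, card_disjSum, card_univ, Fintype.card_fin]
      rw [card_map] at h1
      omega
    obtain ⟨f, hfi, hft⟩ := (all_card_le_biUnion_card_iff_exists_injective t).1 hall
    have hcol : G.Colorable (Y.disjSum (univ : Finset (Fin d))).card := by
      let c : V → V ⊕ Fin d := fun v => if h : v ∉ Y then f ⟨v, h⟩ else Sum.inl v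
      have hfY : ∀ v, f v ∈ Y.disjSum (univ : Finset (Fin d)) := fun v =>
        disjSum_mono (filter_subset _ _) (Subset.refl _) (hft v)
      have hcY : ∀ v, c v ∈ Y.disjSum (univ : Finset (Fin d)) := fun v => by
        by_cases h : v ∉ Y
        · simp only [c, dif_pos h]; exact hfY _
        · simp only [c, dif_neg h, inl_mem_disjSum]; exact not_not.1 h
      have hmix : ∀ v (hv : v ∉ Y) w, w ∈ Y → G.Adj v w → f ⟨v, hv⟩ ≠ Sum.inl w :=
        fun v hv w hw hvw e => by
          have := hft ⟨v, hv⟩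
          rw [e] at this
          simp only [t, N, inl_mem_disjSum, mem_filter, mem_singleton, exists_eq_left] at this
          exact this.2 hvw
      refine colorable_of_forall_mem hcY fun {v w} hvw e => ?_
      by_cases hv : v ∉ Y <;> by_cases hw : w ∉ Y
      · simp only [c, dif_pos hv, dif_pos hw] at e
        exact hvw.ne (congrArg Subtype.val (hfi e))
      · simp only [c, dif_pos hv, dif_neg hw] at e
        exact hmix v hv w (not_not.1 hw) hvw e
      · simp only [c, dif_neg hv, dif_pos hw] at e
        exact hmix w hw v (not_not.1 hv) hvw.symm e.symm
      · simp only [c, dif_neg hv, dif_neg hw] at e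
        exact hvw.ne (Sum.inl_injective e)
    rw [hd]
    rwa [card_disjSum, card_univ, Fintype.card_fin] at hcol

theorem exists_adj_of_indepNum_eq_two (h : G.indepNum = 2) {a b c : V} (hab : a ≠ b)
    (hac : a ≠ c) (hbc : b ≠ c) : G.Adj a b ∨ G.Adj a c ∨ G.Adj b c := by
  by_contra! hn
  have h3 : G.IsIndepSet (({a, b, c} : Finset V) : Set V) := by
    intro v hv w hw hvw
    simp only [coe_insert, coe_singleton, Set.mem_insert_iff, Set.mem_singleton_iff] at hv hw
    rcases hv with rfl | rfl | rfl <;> rcases hw with rfl | rfl | rfl <;>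
      simp_all [G.adj_comm]
  have := h3.card_le_indepNum
  rw [h, card_insert_of_notMem (by simp [hab, hac]), card_pair hbc] at this
  omega

/-- If the connectivity is `2` then some two vertices separate the graph. -/
theorem exists_separation (hcard : 3 < Fintype.card V) (h : G.IsVertexConnected 2)
    (hk : G.vertexConnectivity = 2) : ∃ (A B : Finset V) (u v : V), u ≠ v ∧ A.Nonempty ∧
      B.Nonempty ∧ Disjoint A B ∧ (∀ w, w ∈ A ∨ w ∈ B ↔ w ≠ u ∧ w ≠ v) ∧
      ∀ a ∈ A, ∀ b ∈ B, ¬ G.Adj a b := by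
  have h3 : ¬ G.IsVertexConnected 3 := fun h3 => by
    have : 3 ≤ G.vertexConnectivity :=
      le_csSup ⟨Fintype.card V, fun l hl => hl.1.le⟩ h3
    omega
  simp only [IsVertexConnected, hcard, true_and, not_forall] at h3
  obtain ⟨S, hS3, hS⟩ := h3
  have hS2 : S.card = 2 := by
    by_contra hne
    exact hS (h.2 S (by omega))
  obtain ⟨u, v, huv, rfl⟩ := card_eq_two.1 hS2
  have hne : Nonempty {w : V | w ∉ ({u, v} : Finset V)} := by
    obtain ⟨w, -, hw⟩ := exists_mem_notMem_of_card_lt_card (s := {u, v}) (t := univ)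
      (by rw [hS2, card_univ]; omega)
    exact ⟨w, hw⟩
  have hpre : ¬ (G.induce {w : V | w ∉ ({u, v} : Finset V)}).Preconnected :=
    fun hp => hS ⟨hp⟩
  simp only [Preconnected, not_forall] at hpre
  obtain ⟨a, b, hab⟩ := hpre
  let C : V → Prop := fun w => ∃ hw : w ∉ ({u, v} : Finset V),
    (G.induce {w : V | w ∉ ({u, v} : Finset V)}).Reachable a ⟨w, hw⟩
  refine ⟨univ.filter C, univ.filter fun w => w ∉ ({u, v} : Finset V) ∧ ¬ C w, u, v, huv,
    ⟨a, ?_⟩, ⟨b, ?_⟩, ?_, fun w => ?_, fun p hp q hq hpq => ?_⟩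
  · exact mem_filter.2 ⟨mem_univ _, a.2, Reachable.refl _⟩
  · exact mem_filter.2 ⟨mem_univ _, b.2, fun ⟨_, hr⟩ => hab hr⟩
  · rw [Finset.disjoint_left]
    exact fun w hw hw' => (mem_filter.1 hw').2.2 (mem_filter.1 hw).2
  · have hw : w ∉ ({u, v} : Finset V) ↔ w ≠ u ∧ w ≠ v := by simp
    rw [← hw]
    simp only [mem_filter, mem_univ, true_and]
    refine ⟨fun h => h.elim (fun h => h.1) fun h => h.1, fun h => ?_⟩
    by_cases hC : C w
    · exact Or.inl hC
    · exact Or.inr ⟨h, hC⟩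
  · obtain ⟨hpS, hr⟩ := (mem_filter.1 hp).2
    obtain ⟨hqS, hqC⟩ := (mem_filter.1 hq).2
    have hadj : (G.induce {w : V | w ∉ ({u, v} : Finset V)}).Adj ⟨p, hpS⟩ ⟨q, hqS⟩ := hpq
    exact hqC ⟨hqS, hr.trans hadj.reachable⟩

theorem exists_cobipartite_or_isInflatedPentagon (hcard : 3 < Fintype.card V)
    (h : G.IsVertexConnected 2) (hk : G.vertexConnectivity = 2) (hi : G.indepNum = 2) :
    (∃ Y : Finset V, G.IsClique (Y : Set V) ∧ G.IsClique ((Yᶜ : Finset V) : Set V)) ∨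
      ∃ (A B : Finset V) (u v : V), G.IsInflatedPentagon A B u v := by
  obtain ⟨A, B, u, v, huv, hA, hB, hdisj, hmem, hAB⟩ := exists_separation hcard h hk
  have ind : ∀ {a b c : V}, a ≠ b → a ≠ c → b ≠ c → G.Adj a b ∨ G.Adj a c ∨ G.Adj b c :=
    exists_adj_of_indepNum_eq_two hi
  have hne : ∀ {a b}, a ∈ A → b ∈ B → a ≠ b := fun ha hb =>
    ne_of_mem_of_not_mem ha (disjoint_right.1 hdisj hb)
  have hAc : G.IsClique (A : Set V) := fun a ha a' ha' haa' => by
    obtain ⟨b, hb⟩ := hB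
    exact (ind haa' (hne ha hb) (hne ha' hb)).elim id fun h => h.elim
      (fun h => absurd h (hAB a ha b hb)) fun h => absurd h (hAB a' ha' b hb)
  have hBc : G.IsClique (B : Set V) := fun b hb b' hb' hbb' => by
    obtain ⟨a, ha⟩ := hA
    exact (ind (hne ha hb) (hne ha hb') hbb').elim (fun h => absurd h (hAB a ha b hb))
      fun h => h.elim (fun h => absurd h (hAB a ha b' hb')) id
  -- a vertex of the cut is complete to one of the two sides
  have hside : ∀ w, w ∉ A → w ∉ B → (∀ a ∈ A, G.Adj w a) ∨ ∀ b ∈ B, G.Adj w b := by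
    intro w hwA hwB
    by_contra! hn
    obtain ⟨⟨a, ha, hwa⟩, b, hb, hwb⟩ := hn
    rcases ind (ne_of_mem_of_not_mem ha hwA).symm (ne_of_mem_of_not_mem hb hwB).symm
      (hne ha hb) with h | h | h
    exacts [hwa h, hwb h, hAB a ha b hb h]
  have huA : u ∉ A := fun h => ((hmem u).1 (Or.inl h)).1 rfl
  have huB : u ∉ B := fun h => ((hmem u).1 (Or.inr h)).1 rfl
  have hvA : v ∉ A := fun h => ((hmem v).1 (Or.inl h)).2 rfl
  have hvB : v ∉ B := fun h => ((hmem v).1 (Or.inr h)).2 rfl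
  have hcov : ∀ w, w ∈ A ∨ w ∈ B ∨ w = u ∨ w = v := fun w => by
    have := hmem w; tauto
  -- `u` and `v` attached to opposite sides
  have hopp : ∀ {A B : Finset V} {u v : V}, G.IsClique (A : Set V) → G.IsClique (B : Set V) →
      Disjoint A B → u ≠ v → u ∉ A → u ∉ B → v ∉ A → v ∉ B →
      (∀ w, w ∈ A ∨ w ∈ B ∨ w = u ∨ w = v) → (∀ a ∈ A, G.Adj u a) → (∀ b ∈ B, G.Adj v b) →
      ∃ Y : Finset V, G.IsClique (Y : Set V) ∧ G.IsClique ((Yᶜ : Finset V) : Set V) := by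
    intro A B u v hAc hBc hdisj huv huA huB hvA hvB hcov hu hv
    refine ⟨insert u A, isClique_insert_of_forall hAc hu, ?_⟩
    convert isClique_insert_of_forall hBc hv using 2
    ext w
    simp only [mem_compl, mem_insert, not_or]
    constructor
    · rintro ⟨h1, h2⟩
      rcases hcov w with h | h | h | h
      exacts [absurd h h2, Or.inr h, absurd h h1, Or.inl h]
    · rintro (rfl | h)
      · exact ⟨huv.symm, hvA⟩
      · exact ⟨ne_of_mem_of_not_mem h huB, disjoint_right.1 hdisj h⟩
  -- `u` and `v` attached to the same side only
  have hsame : ∀ {A B : Finset V}, G.IsClique (A : Set V) → G.IsClique (B : Set V) →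
      A.Nonempty → Disjoint A B → u ∉ A → u ∉ B → v ∉ A → v ∉ B →
      (∀ w, w ∈ A ∨ w ∈ B ↔ w ≠ u ∧ w ≠ v) → (∀ a ∈ A, ∀ b ∈ B, ¬ G.Adj a b) →
      (∀ a ∈ A, G.Adj u a) → (∀ a ∈ A, G.Adj v a) → (¬ ∀ b ∈ B, G.Adj u b) →
      (¬ ∀ b ∈ B, G.Adj v b) →
      (∃ Y : Finset V, G.IsClique (Y : Set V) ∧ G.IsClique ((Yᶜ : Finset V) : Set V)) ∨
        ∃ (A B : Finset V) (u v : V), G.IsInflatedPentagon A B u v := by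
    intro A B hAc hBc hA hdisj huA huB hvA hvB hmem hAB hu hv hu' hv'
    by_cases hadj : G.Adj u v
    · left
      refine ⟨B, hBc, ?_⟩
      have hAv := isClique_insert_of_forall hAc hv
      have hAuv : G.IsClique ((insert u (insert v A) : Finset V) : Set V) := by
        refine isClique_insert_of_forall hAv fun w hw => ?_
        rcases mem_insert.1 hw with rfl | hw
        exacts [hadj, hu w hw]
      refine hAuv.subset fun w hw => ?_
      have hwB : w ∉ B := by simpa using hw
      have := hmem w
      simp only [mem_coe, mem_insert]
      tauto
    · right
      push Not at hu' hv'
      refine ⟨A, B, u, v, hAc, hBc, hA, hdisj, huv, hmem, hAB, hadj,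
        fun a ha => ⟨hu a ha, hv a ha⟩, fun b hb => ?_, hu', hv'⟩
      rcases ind huv (ne_of_mem_of_not_mem hb huB).symm (ne_of_mem_of_not_mem hb hvB).symm
        with h | h | h
      exacts [absurd h hadj, Or.inl h, Or.inr h]
  by_cases h1 : (∀ a ∈ A, G.Adj u a) ∧ ∀ b ∈ B, G.Adj v b
  · exact Or.inl (hopp hAc hBc hdisj huv huA huB hvA hvB hcov h1.1 h1.2)
  by_cases h2 : (∀ a ∈ A, G.Adj v a) ∧ ∀ b ∈ B, G.Adj u b
  · exact Or.inl (hopp hAc hBc hdisj huv.symm hvA hvB huA huB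
      (fun w => by have := hcov w; tauto) h2.1 h2.2)
  have hu := hside u huA huB
  have hv := hside v hvA hvB
  by_cases huA' : ∀ a ∈ A, G.Adj u a
  · have hv' : ¬ ∀ b ∈ B, G.Adj v b := fun h => h1 ⟨huA', h⟩
    have hvA' := hv.resolve_right hv'
    exact hsame hAc hBc hA hdisj huA huB hvA hvB hmem hAB huA' hvA'
      (fun h => h2 ⟨hvA', h⟩) hv'
  · have huB' := hu.resolve_left huA'
    have hvA' : ¬ ∀ a ∈ A, G.Adj v a := fun h => h2 ⟨h, huB'⟩
    exact hsame hBc hAc hB hdisj.symm huB huA hvB hvA (fun w => by rw [or_comm]; exact hmem w)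
      (fun b hb a ha h => hAB a ha b hb h.symm) huB' (hv.resolve_left hvA') huA' hvA'

end Structure

/-! ### Cobipartite graphs -/

section Cobipartite

open scoped Classical
open Finset

variable {V : Type*} {G : SimpleGraph V}

theorem exists_adj_adj_of_one_lt_card {Y S T : Finset V} (hY : G.IsClique (Y : Set V))
    (hTS : T ⊆ S) (hTY : T ⊆ Y) (hT : 1 < T.card) {r : V} (hr : r ∈ Y) (hrS : r ∉ S) :
    ∃ s ∈ S, ∃ t ∈ S, G.Adj s t ∧ G.Adj r s ∧ G.Adj r t := by
  obtain ⟨s, hs, t, ht, hst⟩ := one_lt_card.1 hT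
  exact ⟨s, hTS hs, t, hTS ht, hY (hTY hs) (hTY ht) hst,
    hY hr (hTY hs) (ne_of_mem_of_not_mem (hTS hs) hrS).symm,
    hY hr (hTY ht) (ne_of_mem_of_not_mem (hTS ht) hrS).symm⟩

variable [Fintype V] {x : ℕ} [NeZero x]

theorem numColorings_le_pow_mul {S : Finset V}
    (h : ∀ r ∉ S, ∃ s ∈ S, ∃ t ∈ S, G.Adj s t ∧ G.Adj r s ∧ G.Adj r t) :
    G.numColorings x ≤ (x - 2) ^ (Fintype.card V - S.card) * G.numOn x S := by
  rw [numColorings_eq_numOn_univ, ← card_univ]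
  exact numOn_le_pow_mul (subset_univ S) fun r _ hr => h r hr

/-- The case `n = k + 1` with a `k`-clique, with equality only for `G_{k+1,k}`. -/
theorem numColorings_of_card_eq_succ (h : G.IsVertexConnected 2) {K : Finset V}
    (hK : G.IsClique (K : Set V)) (hk : 3 ≤ K.card) (hx : K.card ≤ x)
    (hn : Fintype.card V = K.card + 1) :
    G.numColorings x < x.descFactorial K.card * earCount x 1 ∨
      G.numColorings x = x.descFactorial K.card * earCount x 1 ∧
        Nonempty (G ≃g cliqueWithEar (K.card + 1) K.card) := by
  have hD : 0 < x.descFactorial K.card := Nat.descFactorial_pos.2 hx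
  obtain ⟨p, hp⟩ : ∃ p, Kᶜ = {p} := card_eq_one.1 (by rw [card_compl]; omega)
  have hpK : p ∉ K := mem_compl.1 (by simp [hp])
  have hV : ∀ v, v = p ∨ v ∈ K := fun v => by
    by_cases hv : v ∈ K
    · exact Or.inr hv
    · left; simpa [hp] using mem_compl.2 hv
  have hadj : ∀ z ∈ K, ∃ y ∈ K, y ≠ z ∧ G.Adj p y := fun z hz => by
    obtain ⟨b, hb, hbz⟩ := exists_mem_ne (show 1 < K.card by omega) z
    obtain ⟨q, hq, -, y, hy, hyz, hqy⟩ := h.exists_adj z (mem_singleton_self p)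
      (ne_of_mem_of_not_mem hz hpK).symm
      (by simpa using ne_of_mem_of_not_mem hb hpK) hbz
    rw [mem_singleton] at hq hy
    exact ⟨y, (hV y).resolve_left hy, hyz, hq ▸ hqy⟩
  obtain ⟨b, hb⟩ : K.Nonempty := card_pos.1 (by omega)
  obtain ⟨y, hy, -, hpy⟩ := hadj b hb
  obtain ⟨z, hz, hzy, hpz⟩ := hadj y hy
  by_cases hex : ∃ t ∈ K, t ≠ y ∧ t ≠ z ∧ G.Adj p t
  · left
    obtain ⟨t, ht, hty, htz, hpt⟩ := hex
    have hle : G.numOn x (insert p K) ≤ (x - 3) * G.numOn x K := by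
      have hT : ({t, y, z} : Finset V).card = 3 := by
        rw [card_insert_of_notMem (by simp [hty, htz]), card_pair hzy.symm]
      have hTK : ({t, y, z} : Finset V) ⊆ K := by simp [insert_subset_iff, ht, hy, hz]
      rw [← hT]
      exact numOn_insert_le hpK hTK (hK.subset (by exact_mod_cast hTK)) (by simp [hpt, hpy, hpz])
    have huniv : (univ : Finset V) = insert p K := by ext v; simpa using hV v
    rw [numColorings_eq_numOn_univ, huniv, mul_comm]
    refine hle.trans_lt ?_
    rw [numOn_clique hK, earCount]
    exact Nat.mul_lt_mul_of_pos_right (by omega) hD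
  · right
    push Not at hex
    have hpK' : ∀ t ∈ K, G.Adj p t ↔ t = y ∨ t = z := fun t ht => by
      refine ⟨fun hpt => ?_, ?_⟩
      · by_contra! hne
        exact hex t ht hne.1 hne.2 hpt
      · rintro (rfl | rfl) <;> assumption
    exact ⟨numColorings_of_ear_one hK hpK hV hy hz hzy.symm hpK',
      nonempty_iso_of_ear_one (by omega) hK rfl hpK hV hy hz hzy.symm hpK'⟩

/-- An edge `pq` outside the clique `K` contributes less than an ear with two internal vertices if
`p` has two neighbors in `K`. -/
theorem numColorings_lt_of_adj_two {K : Finset V} (hK : G.IsClique (K : Set V))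
    (hk : 3 ≤ K.card) (hx : K.card ≤ x) {p q y z : V} (hp : p ∉ K) (hq : q ∉ K) (hqp : q ≠ p)
    (hV : ∀ v, v = q ∨ v = p ∨ v ∈ K) (hpq : G.Adj p q) (hy : y ∈ K) (hz : z ∈ K) (hyz : y ≠ z)
    (hpy : G.Adj p y) (hpz : G.Adj p z) :
    G.numColorings x < x.descFactorial K.card * earCount x 2 := by
  have huniv : (univ : Finset V) = insert q (insert p K) := by ext v; simpa using hV v
  rw [numColorings_eq_numOn_univ, huniv]
  calc _ ≤ (x - 1) * G.numOn x (insert p K) :=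
        numOn_insert_le_one (by simp [hq, hqp]) (mem_insert_self _ _) hpq.symm
    _ ≤ (x - 1) * ((x - 2) * G.numOn x K) :=
        Nat.mul_le_mul_left _ (numOn_insert_le_two hp hy hz (hK hy hz hyz) hpy hpz)
    _ = x.descFactorial K.card * ((x - 1) * (x - 2)) := by rw [numOn_clique hK]; ring
    _ < _ := by
        rw [earCount_two (by omega)]
        exact Nat.mul_lt_mul_of_pos_left (Nat.lt_succ_self _) (Nat.descFactorial_pos.2 hx)

/-- The case where the maximum clique is one of the two cliques covering `G`: two disjoint edges
`py`, `qz` leave it, and all further vertices are adjacent to both `p` and `q`. -/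
theorem numColorings_of_isClique_compl (h : G.IsVertexConnected 2) {K : Finset V}
    (hK : G.IsClique (K : Set V)) (hK' : G.IsClique ((Kᶜ : Finset V) : Set V))
    (hk : 3 ≤ K.card) (hx : K.card ≤ x) (hn : K.card + 2 ≤ Fintype.card V) :
    G.numColorings x < x.descFactorial K.card * earCount x (Fintype.card V - K.card) ∨
      G.numColorings x = x.descFactorial K.card * earCount x (Fintype.card V - K.card) ∧
        Nonempty (G ≃g cliqueWithEar (K.card + 2) K.card) := by
  have hD : 0 < x.descFactorial K.card := Nat.descFactorial_pos.2 hx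
  have hcard : 1 < Kᶜ.card := by rw [card_compl]; omega
  obtain ⟨p, hp, q, hq, hpq, y, hy, z, hz, hyz, hpy, hqz⟩ :=
    h.exists_disjoint_adj hcard (by rw [compl_compl]; omega)
  have hpq' : G.Adj p q := hK' hp hq hpq
  rw [mem_compl] at hp hq
  rw [mem_compl, not_not] at hy hz
  have hqS : q ∉ insert p K := by simp [hq, hpq.symm]
  rcases hn.eq_or_lt with hn | hn
  · have hV : ∀ v, v = q ∨ v = p ∨ v ∈ K := by
      have : (insert q (insert p K)) = univ := by
        rw [← card_eq_iff_eq_univ, card_insert_of_notMem hqS, card_insert_of_notMem hp, hn]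
      intro v
      have hv := mem_univ v
      rw [← this] at hv
      simpa using hv
    rw [← hn, Nat.add_sub_cancel_left]
    by_cases hexp : ∃ t ∈ K, t ≠ y ∧ G.Adj p t
    · obtain ⟨t, ht, hty, hpt⟩ := hexp
      exact Or.inl (numColorings_lt_of_adj_two hK hk hx hp hq hpq.symm hV hpq' ht hy hty hpt hpy)
    by_cases hexq : ∃ t ∈ K, t ≠ z ∧ G.Adj q t
    · obtain ⟨t, ht, htz, hqt⟩ := hexq
      exact Or.inl (numColorings_lt_of_adj_two hK hk hx hq hp hpq
        (fun v => by have := hV v; tauto) hpq'.symm ht hz htz hqt hqz)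
    push Not at hexp hexq
    have hpK : ∀ t ∈ K, G.Adj p t ↔ t = y := fun t ht =>
      ⟨fun h => by_contra fun hne => hexp t ht hne h, fun h => h ▸ hpy⟩
    have hqK : ∀ t ∈ K, G.Adj q t ↔ t = z := fun t ht =>
      ⟨fun h => by_contra fun hne => hexq t ht hne h, fun h => h ▸ hqz⟩
    exact Or.inr ⟨numColorings_of_ear_two (by omega) hK hp hq hpq.symm hV hy hz hyz hpq' hpK hqK,
      nonempty_iso_of_ear_two (by omega) hK rfl hp hq hpq.symm hV hy hz hyz hpq' hpK hqK⟩
  · left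
    obtain ⟨j, hj⟩ := Nat.exists_eq_add_of_lt hn
    have hS : (insert q (insert p K)).card = K.card + 2 := by
      rw [card_insert_of_notMem hqS, card_insert_of_notMem hp]
    calc G.numColorings x
        ≤ (x - 2) ^ (Fintype.card V - (K.card + 2)) * G.numOn x (insert q (insert p K)) := by
          rw [← hS]
          refine numColorings_le_pow_mul fun r hr => exists_adj_adj_of_one_lt_card hK'
            (T := {p, q}) ?_ ?_ ?_ ?_ hr
          · simp [insert_subset_iff]
          · simp [insert_subset_iff, hp, hq]
          · rw [card_pair hpq]; omega
          · rw [mem_compl]; exact fun h => hr (by simp [h])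
      _ ≤ (x - 2) ^ (j + 1) * (earCount x 2 * x.descFactorial K.card) := by
          rw [show Fintype.card V - (K.card + 2) = j + 1 by omega]
          refine Nat.mul_le_mul_left _ ?_
          rw [earCount_two (by omega), ← numOn_clique (x := x) hK]
          exact numOn_insert_insert_le hp hqS hy hz hpq'.symm hpy hqz
      _ = x.descFactorial K.card * ((x - 2) ^ (j + 1) * earCount x 2) := by ring
      _ < _ := by
          rw [show Fintype.card V - K.card = (j + 1) + 1 + 1 by omega]
          exact Nat.mul_lt_mul_of_pos_left (pow_mul_earCount_lt (by omega) (by omega) 1) hD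

theorem numColorings_lt_of_forall {K : Finset V} (hK : G.IsClique (K : Set V))
    (hk : 3 ≤ K.card) (hx : K.card ≤ x) (hn : K.card + 2 ≤ Fintype.card V)
    (h : ∀ r ∉ K, ∃ s ∈ K, ∃ t ∈ K, G.Adj s t ∧ G.Adj r s ∧ G.Adj r t) :
    G.numColorings x < x.descFactorial K.card * earCount x (Fintype.card V - K.card) := by
  refine (numColorings_le_pow_mul h).trans_lt ?_
  rw [numOn_clique hK, mul_comm]
  exact Nat.mul_lt_mul_of_pos_left (pow_lt_earCount (by omega) (by omega))
    (Nat.descFactorial_pos.2 hx)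

/-- The case where the maximum clique `K` has exactly one vertex `w` outside `Y`. As `w` is not a
cut vertex, some other vertex `r` outside `Y` has a neighbor `y ∈ Y`; coloring `r`, after `y` if `y`
is not in `K`, provides the adjacent pair `r`, `w` for the rest of `Yᶜ`. -/
theorem numColorings_lt_of_sdiff_eq_singleton (h : G.IsVertexConnected 2) {K Y : Finset V}
    (hK : G.IsClique (K : Set V)) (hY : G.IsClique (Y : Set V))
    (hY' : G.IsClique ((Yᶜ : Finset V) : Set V)) (hk : 4 ≤ K.card) (hx : K.card ≤ x)
    (hn : K.card + 2 ≤ Fintype.card V) {w : V} (hw : K \ Y = {w}) :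
    G.numColorings x < x.descFactorial K.card * earCount x (Fintype.card V - K.card) := by
  have hD : 0 < x.descFactorial K.card := Nat.descFactorial_pos.2 hx
  have hwm : w ∈ K \ Y := by simp [hw]
  rw [mem_sdiff] at hwm
  have hKw : K.erase w ⊆ Y := fun v hv => by
    rw [mem_erase] at hv
    by_contra hvY
    have : v ∈ K \ Y := mem_sdiff.2 ⟨hv.2, hvY⟩
    rw [hw, mem_singleton] at this
    exact hv.1 this
  have hKwc : (K.erase w).card = K.card - 1 := card_erase_of_mem hwm.1
  have hpair : ∀ {S : Finset V}, K ⊆ S → ∀ {r : V}, r ∈ Y → r ∉ S →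
      ∃ s ∈ S, ∃ t ∈ S, G.Adj s t ∧ G.Adj r s ∧ G.Adj r t := fun hKS _ hr hrS =>
    exists_adj_adj_of_one_lt_card hY ((erase_subset w K).trans hKS) hKw (by omega) hr hrS
  by_cases hex : ∃ a ∈ Yᶜ, a ≠ w
  · obtain ⟨a, ha, haw⟩ := hex
    obtain ⟨b, hb⟩ : (K.erase w).Nonempty := card_pos.1 (by omega)
    obtain ⟨r, hr, hrw, y, hy, -, hry⟩ := h.exists_adj w ha haw
      (b := b) (by rw [mem_compl, not_not]; exact hKw hb) (ne_of_mem_erase hb)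
    have hrY := mem_compl.1 hr
    rw [mem_compl, not_not] at hy
    have hrK : r ∉ K := fun hrK => hrY (hKw (mem_erase.2 ⟨hrw, hrK⟩))
    have hwY : w ∈ Yᶜ := mem_compl.2 hwm.2
    have hrw' : G.Adj r w := hY' hr hwY hrw
    have hrest : ∀ {S : Finset V}, K ⊆ S → r ∈ S → ∀ s ∉ S,
        ∃ u ∈ S, ∃ t ∈ S, G.Adj u t ∧ G.Adj s u ∧ G.Adj s t := fun {S} hKS hrS s hs => by
      by_cases hsY : s ∈ Y
      · exact hpair hKS hsY hs
      · exact ⟨r, hrS, w, hKS hwm.1, hrw', hY' (mem_compl.2 hsY) hr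
          (ne_of_mem_of_not_mem hrS hs).symm,
          hY' (mem_compl.2 hsY) hwY (ne_of_mem_of_not_mem (hKS hwm.1) hs).symm⟩
    by_cases hyK : y ∈ K
    · calc G.numColorings x
          ≤ (x - 2) ^ (Fintype.card V - (K.card + 1)) * G.numOn x (insert r K) := by
            rw [← card_insert_of_notMem hrK]
            exact numColorings_le_pow_mul (hrest (subset_insert _ _) (mem_insert_self _ _))
        _ ≤ (x - 2) ^ (Fintype.card V - (K.card + 1)) *
              ((x - 2) * x.descFactorial K.card) := by
            refine Nat.mul_le_mul_left _ ?_
            rw [← numOn_clique (x := x) hK]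
            exact numOn_insert_le_two hrK hwm.1 hyK
              (hK hwm.1 hyK (ne_of_mem_of_not_mem hy hwm.2).symm) hrw' hry
        _ = x.descFactorial K.card * (x - 2) ^ (Fintype.card V - K.card) := by
            rw [show Fintype.card V - K.card = Fintype.card V - (K.card + 1) + 1 by omega]
            ring
        _ < _ := Nat.mul_lt_mul_of_pos_left (pow_lt_earCount (by omega) (by omega)) hD
    · have hrS : r ∉ insert y K := by
        simp [hrK, (ne_of_mem_of_not_mem hy hrY).symm]
      calc G.numColorings x
          ≤ (x - 2) ^ (Fintype.card V - (K.card + 2)) *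
              G.numOn x (insert r (insert y K)) := by
            rw [show K.card + 2 = K.card + 1 + 1 from rfl, ← card_insert_of_notMem hyK,
              ← card_insert_of_notMem hrS]
            exact numColorings_le_pow_mul (hrest ((subset_insert _ _).trans (subset_insert _ _))
              (mem_insert_self _ _))
        _ ≤ (x - 2) ^ (Fintype.card V - (K.card + 2)) *
              ((x - 1) * G.numOn x (insert y K)) :=
            Nat.mul_le_mul_left _ (numOn_insert_le_one hrS (mem_insert_self _ _) hry)
        _ ≤ (x - 2) ^ (Fintype.card V - (K.card + 2)) *
              ((x - 1) * ((x - 3) * x.descFactorial K.card)) := by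
            refine Nat.mul_le_mul_left _ (Nat.mul_le_mul_left _ ?_)
            rw [← numOn_clique (x := x) hK]
            refine (numOn_insert_le (T := K.erase w) hyK (erase_subset _ _)
              (hK.subset (by simp)) fun t ht => hY hy (hKw ht) ?_).trans
              (Nat.mul_le_mul_right _ (by omega))
            rintro rfl
            exact hyK (mem_of_mem_erase ht)
        _ = x.descFactorial K.card *
              ((x - 2) ^ (Fintype.card V - K.card - 2) * ((x - 1) * (x - 3))) := by
            rw [Nat.sub_sub]; ring
        _ < _ := Nat.mul_lt_mul_of_pos_left (pow_mul_lt_earCount_of_lt_two (by omega) (by omega)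
            (sub_one_mul_sub_three_lt (by omega))) hD
  · push Not at hex
    refine numColorings_lt_of_forall hK (by omega) hx hn fun r hr => ?_
    have hrY : r ∈ Y := by
      by_contra hrY
      exact hr (hex r (mem_compl.2 hrY) ▸ hwm.1)
    exact hpair (Subset.refl K) hrY hr

/-- The case `n ≥ k + 2`, where `Y` is a covering clique that meets the maximum clique `K` in at
least two vertices. -/
theorem numColorings_of_cobipartite_aux (h : G.IsVertexConnected 2) {K Y : Finset V}
    (hK : G.IsClique (K : Set V)) (hY : G.IsClique (Y : Set V))
    (hY' : G.IsClique ((Yᶜ : Finset V) : Set V)) (hk : 4 ≤ K.card) (hx : K.card ≤ x)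
    (hmax : ∀ L : Finset V, G.IsClique (L : Set V) → L.card ≤ K.card)
    (hn : K.card + 2 ≤ Fintype.card V) (hKY : 1 < (K ∩ Y).card) :
    G.numColorings x < x.descFactorial K.card * earCount x (Fintype.card V - K.card) ∨
      G.numColorings x = x.descFactorial K.card * earCount x (Fintype.card V - K.card) ∧
        Nonempty (G ≃g cliqueWithEar (K.card + 2) K.card) := by
  rcases Nat.lt_trichotomy (K \ Y).card 1 with h0 | h1 | h2
  · have hsub : K ⊆ Y := by
      rw [← sdiff_eq_empty_iff_subset, ← card_eq_zero]; omega
    obtain rfl : K = Y := eq_of_subset_of_card_le hsub (hmax Y hY)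
    exact numColorings_of_isClique_compl h hK hY' (by omega) hx hn
  · obtain ⟨w, hw⟩ := card_eq_one.1 h1
    exact Or.inl (numColorings_lt_of_sdiff_eq_singleton h hK hY hY' hk hx hn hw)
  · refine Or.inl (numColorings_lt_of_forall hK (by omega) hx hn fun r hr => ?_)
    by_cases hrY : r ∈ Y
    · exact exists_adj_adj_of_one_lt_card hY inter_subset_left inter_subset_right hKY hrY hr
    · exact exists_adj_adj_of_one_lt_card hY' sdiff_subset
        (fun v hv => mem_compl.2 (mem_sdiff.1 hv).2) h2 (mem_compl.2 hrY) hr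

/-- The bound for `2`-connected cobipartite graphs, with equality only for the two graphs with a
short ear. -/
theorem numColorings_of_cobipartite (h : G.IsVertexConnected 2) {k : ℕ} {Y : Finset V}
    (hY : G.IsClique (Y : Set V)) (hY' : G.IsClique ((Yᶜ : Finset V) : Set V)) (hk : 4 ≤ k)
    (hx : k ≤ x) (hn : k < Fintype.card V) (hχ : G.chromaticNumber = (k : ℕ∞)) :
    G.numColorings x < x.descFactorial k * earCount x (Fintype.card V - k) ∨
      G.numColorings x = x.descFactorial k * earCount x (Fintype.card V - k) ∧
        (Nonempty (G ≃g cliqueWithEar (k + 1) k) ∨ Nonempty (G ≃g cliqueWithEar (k + 2) k)) := by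
  have hmax : ∀ L : Finset V, G.IsClique (L : Set V) → L.card ≤ k := fun L hL => by
    have := hL.card_le_chromaticNumber
    rw [hχ] at this
    exact_mod_cast this
  obtain ⟨K, hK, hcol⟩ := exists_clique_colorable hY hY'
  obtain rfl : K.card = k := by
    refine le_antisymm (hmax K hK) ?_
    have := chromaticNumber_le_iff_colorable.2 hcol
    rw [hχ] at this
    exact_mod_cast this
  rcases (Nat.succ_le_of_lt hn).eq_or_lt with hn1 | hn2
  · have hn1 : Fintype.card V = K.card + 1 := hn1.symm
    rw [hn1, Nat.add_sub_cancel_left]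
    exact (numColorings_of_card_eq_succ h hK (by omega) hx hn1).imp_right
      fun h => ⟨h.1, Or.inl h.2⟩
  · by_cases hKY : 1 < (K ∩ Y).card
    · exact (numColorings_of_cobipartite_aux h hK hY hY' hk hx hmax hn2 hKY).imp_right
        fun h => ⟨h.1, Or.inr h.2⟩
    · have hKY' : 1 < (K ∩ Yᶜ).card := by
        have := card_inter_add_card_sdiff K Y
        rw [← sdiff_eq_inter_compl]
        omega
      exact (numColorings_of_cobipartite_aux h hK hY' (by rwa [compl_compl]) hk hx hmax hn2
        hKY').imp_right fun h => ⟨h.1, Or.inr h.2⟩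

end Cobipartite

/-! ### Inflated pentagons -/

section InflatedPentagon

open scoped Classical
open Finset Function

variable {V : Type*} {G : SimpleGraph V} {A B : Finset V} {u v : V}

theorem exists_injOn_of_card_le (h : A.card ≤ B.card) :
    ∃ f : V → V, (∀ a ∈ A, f a ∈ B) ∧ ∀ a ∈ A, ∀ a' ∈ A, f a = f a' → a = a' := by
  rcases isEmpty_or_nonempty V with hV | hV
  · exact ⟨id, fun a => (hV.false a).elim, fun a => (hV.false a).elim⟩
  obtain ⟨f, hf, hi⟩ := A.finite_toSet.exists_injOn_of_encard_le (t := (B : Set V))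
    (by simpa [Set.encard_coe_eq_coe_finsetCard] using h)
  exact ⟨f, fun a ha => hf ha, fun a ha a' ha' e => hi ha ha' e⟩

/-- Two cliques without edges between them and two further nonadjacent vertices are colored with one
color more than the larger clique needs. -/
theorem colorable_card_add_one (hdisj : Disjoint A B)
    (hmem : ∀ w, w ∈ A ∨ w ∈ B ↔ w ≠ u ∧ w ≠ v) (huv : ¬ G.Adj u v)
    (hAB : ∀ a ∈ A, ∀ b ∈ B, ¬ G.Adj a b) (h : A.card ≤ B.card) : G.Colorable (B.card + 1) := by
  obtain ⟨f, hfB, hfi⟩ := exists_injOn_of_card_le h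
  have huB : u ∉ B := fun h => ((hmem u).1 (Or.inr h)).1 rfl
  have hcases : ∀ w, (w ∉ A ∧ w ∉ B ∧ (w = u ∨ w = v)) ∨ w ∈ A ∨ w ∈ B := fun w => by
    have := hmem w; tauto
  rw [← card_insert_of_notMem huB]
  -- match `A` into `B` and give `u` and `v` one further common color
  obtain ⟨F, hFO, hFA, hFB⟩ : ∃ F : V → V, (∀ w, w ∉ A → w ∉ B → F w = u) ∧
      (∀ a ∈ A, F a = f a) ∧ ∀ b ∈ B, F b = b :=
    ⟨fun w => if w ∈ A then f w else if w ∈ B then w else u,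
      fun w h1 h2 => by simp [h1, h2], fun a ha => if_pos ha, fun b hb => by
        simp [Finset.disjoint_right.1 hdisj hb, hb]⟩
  have hFAu : ∀ a ∈ A, F a ≠ u := fun a ha => by
    rw [hFA a ha]; exact ne_of_mem_of_not_mem (hfB a ha) huB
  have hFBu : ∀ b ∈ B, F b ≠ u := fun b hb => by
    rw [hFB b hb]; exact ne_of_mem_of_not_mem hb huB
  refine colorable_of_forall_mem (c := F) (fun w => ?_) fun {w z} hwz => ?_
  · rcases hcases w with ⟨h1, h2, -⟩ | hw | hw
    · rw [hFO w h1 h2]; exact mem_insert_self _ _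
    · rw [hFA w hw]; exact mem_insert_of_mem (hfB w hw)
    · rw [hFB w hw]; exact mem_insert_of_mem hw
  · rcases hcases w with ⟨w1, w2, hw⟩ | hw | hw <;> rcases hcases z with ⟨z1, z2, hz⟩ | hz | hz
    · rcases hw with rfl | rfl <;> rcases hz with rfl | rfl
      exacts [absurd rfl hwz.ne, absurd hwz huv, absurd hwz.symm huv, absurd rfl hwz.ne]
    · rw [hFO w w1 w2]; exact (hFAu z hz).symm
    · rw [hFO w w1 w2]; exact (hFBu z hz).symm
    · rw [hFO z z1 z2]; exact hFAu w hw
    · rw [hFA w hw, hFA z hz]; exact fun e => hwz.ne (hfi w hw z hz e)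
    · exact absurd hwz (hAB w hw z hz)
    · rw [hFO z z1 z2]; exact hFBu w hw
    · exact absurd hwz.symm (hAB z hz w hw)
    · rw [hFB w hw, hFB z hz]; exact hwz.ne

namespace IsInflatedPentagon

theorem swap (H : G.IsInflatedPentagon A B u v) : G.IsInflatedPentagon A B v u where
  isClique_left := H.isClique_left
  isClique_right := H.isClique_right
  nonempty := H.nonempty
  disjoint := H.disjoint
  ne := H.ne.symm
  mem_iff w := by rw [and_comm]; exact H.mem_iff w
  not_adj := H.not_adj
  not_adj_ends h := H.not_adj_ends h.symm
  adj_left a ha := (H.adj_left a ha).symm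
  adj_right b hb := (H.adj_right b hb).symm
  exists_not_adj_fst := H.exists_not_adj_snd
  exists_not_adj_snd := H.exists_not_adj_fst

theorem fst_notMem_left (H : G.IsInflatedPentagon A B u v) : u ∉ A :=
  fun h => ((H.mem_iff u).1 (Or.inl h)).1 rfl

theorem fst_notMem_right (H : G.IsInflatedPentagon A B u v) : u ∉ B :=
  fun h => ((H.mem_iff u).1 (Or.inr h)).1 rfl

theorem mem_cases (H : G.IsInflatedPentagon A B u v) (w : V) :
    w = u ∨ w = v ∨ w ∈ A ∨ w ∈ B := by
  have := H.mem_iff w; tauto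

theorem isClique_insert_fst (H : G.IsInflatedPentagon A B u v) :
    G.IsClique ((insert u A : Finset V) : Set V) :=
  isClique_insert_of_forall H.isClique_left fun a ha => (H.adj_left a ha).1

theorem exists_adj_pair (H : G.IsInflatedPentagon A B u v) :
    ∃ b ∈ B, ∃ c ∈ B, b ≠ c ∧ G.Adj u b ∧ ¬ G.Adj v b ∧ G.Adj v c ∧ ¬ G.Adj u c := by
  obtain ⟨b, hb, hvb⟩ := H.exists_not_adj_snd
  obtain ⟨c, hc, huc⟩ := H.exists_not_adj_fst
  have hub := (H.adj_right b hb).resolve_right hvb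
  exact ⟨b, hb, c, hc, fun h => huc (h ▸ hub), hub, hvb, (H.adj_right c hc).resolve_left huc, huc⟩

theorem card_le_card_filter_add (H : G.IsInflatedPentagon A B u v) :
    B.card ≤ (B.filter (G.Adj u)).card + (B.filter (G.Adj v)).card := by
  refine le_trans (card_le_card fun b hb => ?_) (card_union_le _ _)
  simpa [hb] using H.adj_right b hb

/-- If `B` is large, `u` and `v` can each repeat the color of a nonneighbor in `B`, and `A` repeats
other colors of `B`. -/
theorem colorable_card_right (H : G.IsInflatedPentagon A B u v) (h : A.card + 2 ≤ B.card) :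
    G.Colorable B.card := by
  obtain ⟨b, hb, c, hc, hbc, hub, hvb, hvc, huc⟩ := H.exists_adj_pair
  have hBbc : ((B.erase b).erase c).card = B.card - 2 := by
    rw [card_erase_of_mem (by simp [hc, hbc.symm]), card_erase_of_mem hb]; rfl
  obtain ⟨f, hf, hfi⟩ := exists_injOn_of_card_le (A := A) (B := (B.erase b).erase c) (by omega)
  simp only [mem_erase] at hf
  have huA := H.fst_notMem_left
  have huB := H.fst_notMem_right
  have hvA := H.swap.fst_notMem_left
  have hvB := H.swap.fst_notMem_right
  obtain ⟨F, hFu, hFv, hFA, hFB⟩ : ∃ F : V → V, F u = c ∧ F v = b ∧ (∀ a ∈ A, F a = f a) ∧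
      ∀ d ∈ B, F d = d := by
    refine ⟨fun w => if w ∈ A then f w else if w ∈ B then w else if w = u then c else b,
      by simp [huA, huB], by simp [hvA, hvB, H.ne.symm], fun a ha => if_pos ha, fun d hd => ?_⟩
    simp [Finset.disjoint_right.1 H.disjoint hd, hd]
  refine colorable_of_forall_mem (c := F) (fun w => ?_) fun {w z} hwz => ?_
  · rcases H.mem_cases w with rfl | rfl | hw | hw
    · rwa [hFu]
    · rwa [hFv]
    · rw [hFA w hw]; exact (hf w hw).2.2
    · rwa [hFB w hw]
  · rcases H.mem_cases w with rfl | rfl | hw | hw <;> rcases H.mem_cases z with rfl | rfl | hz | hz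
    · exact absurd rfl hwz.ne
    · exact absurd hwz H.not_adj_ends
    · rw [hFu, hFA z hz]; exact (hf z hz).1.symm
    · rw [hFu, hFB z hz]; rintro rfl; exact huc hwz
    · exact absurd hwz.symm H.not_adj_ends
    · exact absurd rfl hwz.ne
    · rw [hFv, hFA z hz]; exact (hf z hz).2.1.symm
    · rw [hFv, hFB z hz]; rintro rfl; exact hvb hwz
    · rw [hFu, hFA w hw]; exact (hf w hw).1
    · rw [hFv, hFA w hw]; exact (hf w hw).2.1
    · rw [hFA w hw, hFA z hz]; exact fun e => hwz.ne (hfi w hw z hz e)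
    · exact absurd hwz (H.not_adj w hw z hz)
    · rw [hFu, hFB w hw]; rintro rfl; exact huc hwz.symm
    · rw [hFv, hFB w hw]; rintro rfl; exact hvb hwz.symm
    · exact absurd hwz.symm (H.not_adj z hz w hw)
    · rw [hFB w hw, hFB z hz]; exact hwz.ne

variable [Fintype V] {x : ℕ} [NeZero x]

theorem card_eq (H : G.IsInflatedPentagon A B u v) :
    Fintype.card V = A.card + B.card + 2 := by
  have huniv : (univ : Finset V) = insert u (insert v (A ∪ B)) := by
    ext w; simpa using H.mem_cases w
  rw [← card_univ, huniv, card_insert_of_notMem, card_insert_of_notMem,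
    card_union_of_disjoint H.disjoint]
  · simp [H.swap.fst_notMem_left, H.swap.fst_notMem_right]
  · simp [H.fst_notMem_left, H.fst_notMem_right, H.ne]

/-- The case `#B ≤ #A`, where `A ∪ {u}` is a `k`-clique for `k = #A + 1`. -/
theorem numColorings_lt_of_left (H : G.IsInflatedPentagon A B u v) (hA : 3 ≤ A.card)
    (hx : A.card + 1 ≤ x) :
    G.numColorings x < x.descFactorial (A.card + 1) * earCount x (B.card + 1) := by
  have hD : 0 < x.descFactorial (A.card + 1) := Nat.descFactorial_pos.2 hx
  obtain ⟨b, hb, c, hc, hbc, hub, -, -, -⟩ := H.exists_adj_pair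
  have hB2 : 2 ≤ B.card := by
    rw [← card_pair hbc]; exact card_le_card (by simp [insert_subset_iff, hb, hc])
  have huA := H.fst_notMem_left
  have hK : (insert u A).card = A.card + 1 := card_insert_of_notMem huA
  have hbA := Finset.disjoint_right.1 H.disjoint hb
  have hcA := Finset.disjoint_right.1 H.disjoint hc
  have hbu := ne_of_mem_of_not_mem hb H.fst_notMem_right
  have hcu := ne_of_mem_of_not_mem hc H.fst_notMem_right
  have hbv := ne_of_mem_of_not_mem hb H.swap.fst_notMem_right
  have hcv := ne_of_mem_of_not_mem hc H.swap.fst_notMem_right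
  have hv : v ∉ insert u A := by simp [H.ne.symm, H.swap.fst_notMem_left]
  have hb' : b ∉ insert v (insert u A) := by simp [hbv, hbu, hbA]
  have hc' : c ∉ insert b (insert v (insert u A)) := by simp [hbc.symm, hcv, hcu, hcA]
  have hS : (insert c (insert b (insert v (insert u A)))).card = A.card + 4 := by
    rw [card_insert_of_notMem hc', card_insert_of_notMem hb', card_insert_of_notMem hv, hK]
  have hbc' : G.Adj b c := H.isClique_right hb hc hbc
  calc G.numColorings x
      ≤ (x - 2) ^ (Fintype.card V - (A.card + 4)) *
          G.numOn x (insert c (insert b (insert v (insert u A)))) := by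
        rw [← hS]
        refine numColorings_le_pow_mul fun r hr => ?_
        simp only [mem_insert, not_or] at hr
        have hrB : r ∈ B := by have := H.mem_cases r; tauto
        exact ⟨b, by simp, c, by simp, hbc', H.isClique_right hrB hb hr.2.1,
          H.isClique_right hrB hc hr.1⟩
    _ ≤ (x - 2) ^ (Fintype.card V - (A.card + 4)) *
          ((x - 1) * ((x - 1) * ((x - 3) * x.descFactorial (A.card + 1)))) := by
        refine Nat.mul_le_mul_left _ ((numOn_insert_le_one hc' (mem_insert_self _ _)
          hbc'.symm).trans (Nat.mul_le_mul_left _ ((numOn_insert_le_one hb' (s := u) (by simp)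
          hub.symm).trans (Nat.mul_le_mul_left _ ?_))))
        rw [← hK, ← numOn_clique (x := x) H.isClique_insert_fst]
        exact (numOn_insert_le hv (subset_insert _ _) H.isClique_left fun a ha =>
          (H.adj_left a ha).2).trans (Nat.mul_le_mul_right _ (by omega))
    _ = x.descFactorial (A.card + 1) *
          ((x - 2) ^ (B.card + 1 - 3) * ((x - 3) * ((x - 1) * (x - 1)))) := by
        rw [H.card_eq, show A.card + B.card + 2 - (A.card + 4) = B.card + 1 - 3 by omega]
        ring
    _ < _ := Nat.mul_lt_mul_of_pos_left (pow_mul_lt_earCount_of_lt_three (by omega) (by omega)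
        (sub_one_sq_mul_sub_three_lt (by omega))) hD

/-- The case where `B` is a `k`-clique. The vertices `u`, `v` together have at least `#B ≥ 4`
neighbors in `B`, which makes up for the factor `x - 1` of the first vertex of `A`. -/
theorem numColorings_lt_of_right (H : G.IsInflatedPentagon A B u v) (hB : 4 ≤ B.card)
    (hx : B.card ≤ x) :
    G.numColorings x < x.descFactorial B.card * earCount x (A.card + 2) := by
  have hD : 0 < x.descFactorial B.card := Nat.descFactorial_pos.2 hx
  obtain ⟨b, hb, c, hc, hbc, hub, -, hvc, -⟩ := H.exists_adj_pair
  obtain ⟨a, ha⟩ := H.nonempty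
  have hA := card_pos.2 ⟨a, ha⟩
  have huB := H.fst_notMem_right
  have haB := Finset.disjoint_left.1 H.disjoint ha
  have hau := ne_of_mem_of_not_mem ha H.fst_notMem_left
  have hav := ne_of_mem_of_not_mem ha H.swap.fst_notMem_left
  have hv : v ∉ insert u B := by simp [H.ne.symm, H.swap.fst_notMem_right]
  have ha' : a ∉ insert v (insert u B) := by simp [hau, hav, haB]
  have hS : (insert a (insert v (insert u B))).card = B.card + 3 := by
    rw [card_insert_of_notMem ha', card_insert_of_notMem hv, card_insert_of_notMem huB]
  have hua := (H.adj_left a ha).1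
  have hdu : 1 ≤ (B.filter (G.Adj u)).card := card_pos.2 ⟨b, by simp [hb, hub]⟩
  have hdv : 1 ≤ (B.filter (G.Adj v)).card := card_pos.2 ⟨c, by simp [hc, hvc]⟩
  have hduv := H.card_le_card_filter_add
  calc G.numColorings x
      ≤ (x - 2) ^ (Fintype.card V - (B.card + 3)) *
          G.numOn x (insert a (insert v (insert u B))) := by
        rw [← hS]
        refine numColorings_le_pow_mul fun r hr => ?_
        simp only [mem_insert, not_or] at hr
        have hrA : r ∈ A := by have := H.mem_cases r; tauto
        exact ⟨u, by simp, a, by simp, hua, (H.adj_left r hrA).1.symm,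
          H.isClique_left hrA ha hr.1⟩
    _ ≤ (x - 2) ^ (Fintype.card V - (B.card + 3)) *
          ((x - 1) * ((x - (B.filter (G.Adj v)).card) *
            ((x - (B.filter (G.Adj u)).card) * x.descFactorial B.card))) := by
        have hfilter : ∀ w, G.IsClique ((B.filter (G.Adj w) : Finset V) : Set V) := fun w =>
          H.isClique_right.subset (by exact_mod_cast filter_subset _ B)
        rw [← numOn_clique (x := x) H.isClique_right]
        refine Nat.mul_le_mul_left _ ((numOn_insert_le_one ha' (s := u) (by simp)
          hua.symm).trans (Nat.mul_le_mul_left _ ((numOn_insert_le hv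
            ((filter_subset _ _).trans (subset_insert _ _)) (hfilter v) fun t ht =>
            (mem_filter.1 ht).2).trans (Nat.mul_le_mul_left _ (numOn_insert_le huB
            (filter_subset _ _) (hfilter u) fun t ht => (mem_filter.1 ht).2)))))
    _ = x.descFactorial B.card * ((x - 2) ^ (A.card + 2 - 3) * ((x - 1) *
          ((x - (B.filter (G.Adj v)).card) * (x - (B.filter (G.Adj u)).card)))) := by
        rw [H.card_eq, show A.card + B.card + 2 - (B.card + 3) = A.card + 2 - 3 by omega]
        ring
    _ < _ := by
        refine Nat.mul_lt_mul_of_pos_left (pow_mul_lt_earCount_of_lt_three (by omega) (by omega)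
          ?_) hD
        generalize (B.filter (G.Adj u)).card = d at *
        generalize (B.filter (G.Adj v)).card = e at *
        have h13 := sub_one_sq_mul_sub_three_lt (x := x) (by omega)
        rcases Nat.lt_or_ge e 2 with he | he
        · calc _ ≤ (x - 1) * ((x - 1) * (x - 3)) := by gcongr; omega
            _ = (x - 3) * ((x - 1) * (x - 1)) := by ring
            _ < _ := h13
        rcases Nat.lt_or_ge d 2 with hd | hd
        · calc _ ≤ (x - 1) * ((x - 3) * (x - 1)) := by gcongr; omega
            _ = (x - 3) * ((x - 1) * (x - 1)) := by ring
            _ < _ := h13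
        · calc _ ≤ (x - 1) * ((x - 2) * (x - 2)) := by gcongr
            _ = (x - 2) * ((x - 1) * (x - 2)) := by ring
            _ < (x - 2) * ((x - 1) ^ 2 + 1) := by
              refine Nat.mul_lt_mul_of_pos_left (Nat.lt_succ_of_le ?_) (by omega)
              rw [sq]
              exact Nat.mul_le_mul_left _ (by omega)
            _ = _ := (earCount_three (by omega)).symm

theorem card_filter_apply_ne_le (H : G.IsInflatedPentagon A B u v) (hB : 3 ≤ B.card)
    (hAB : B.card = A.card + 1) :
    ((G.coloringsOn x univ).filter fun c => ¬ c u = c v).card ≤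
      (x - 2) ^ (B.card - 1) * ((x - 1) * ((x - B.card) * x.descFactorial B.card)) := by
  -- colorings with `c u ≠ c v` are the colorings of `G` with the edge `uv` added
  let G' := G ⊔ edge u v
  have hG : G ≤ G' := le_sup_left
  have huv : G'.Adj u v := Or.inr ((edge_adj u v u v).2 ⟨Or.inl ⟨rfl, rfl⟩, H.ne⟩)
  have hsub : ((G.coloringsOn x univ).filter fun c => ¬ c u = c v).card ≤ G'.numOn x univ := by
    refine card_le_card fun c hc => ?_
    rw [mem_filter, mem_coloringsOn] at hc
    refine mem_coloringsOn.2 ⟨hc.1.1, fun s hs t ht hst => ?_⟩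
    rcases hst with hst | hst
    · exact hc.1.2 s hs t ht hst
    · rcases ((edge_adj _ _ _ _).1 hst).1 with ⟨rfl, rfl⟩ | ⟨rfl, rfl⟩
      · exact hc.2
      · exact fun e => hc.2 e.symm
  refine hsub.trans ?_
  have huA := H.fst_notMem_left
  have hK : (insert u A).card = B.card := by rw [card_insert_of_notMem huA, hAB]
  have hKc : G'.IsClique ((insert u A : Finset V) : Set V) := H.isClique_insert_fst.mono hG
  have hv : v ∉ insert u A := by simp [H.ne.symm, H.swap.fst_notMem_left]
  -- one end of the missing edge has two neighbors in `B`
  obtain ⟨z, hz, b, hb, c, hc, hbc, hzb, hzc⟩ : ∃ z ∈ insert v (insert u A), ∃ b ∈ B, ∃ c ∈ B,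
      b ≠ c ∧ G.Adj z b ∧ G.Adj z c := by
    have hduv := H.card_le_card_filter_add
    rcases Nat.lt_or_ge 1 (B.filter (G.Adj u)).card with h | h
    · obtain ⟨b, hb, c, hc, hbc⟩ := one_lt_card.1 h
      rw [mem_filter] at hb hc
      exact ⟨u, by simp, b, hb.1, c, hc.1, hbc, hb.2, hc.2⟩
    · obtain ⟨b, hb, c, hc, hbc⟩ := one_lt_card.1
        (show 1 < (B.filter (G.Adj v)).card by omega)
      rw [mem_filter] at hb hc
      exact ⟨v, by simp, b, hb.1, c, hc.1, hbc, hb.2, hc.2⟩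
  have hbA := Finset.disjoint_right.1 H.disjoint hb
  have hcA := Finset.disjoint_right.1 H.disjoint hc
  have hbu := ne_of_mem_of_not_mem hb H.fst_notMem_right
  have hcu := ne_of_mem_of_not_mem hc H.fst_notMem_right
  have hbv := ne_of_mem_of_not_mem hb H.swap.fst_notMem_right
  have hcv := ne_of_mem_of_not_mem hc H.swap.fst_notMem_right
  have hb' : b ∉ insert v (insert u A) := by simp [hbv, hbu, hbA]
  have hc' : c ∉ insert b (insert v (insert u A)) := by simp [hbc.symm, hcv, hcu, hcA]
  have hS : (insert c (insert b (insert v (insert u A)))).card = B.card + 3 := by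
    rw [card_insert_of_notMem hc', card_insert_of_notMem hb', card_insert_of_notMem hv, hK]
  have hbc' : G.Adj b c := H.isClique_right hb hc hbc
  calc G'.numOn x univ
      ≤ (x - 2) ^ (Fintype.card V - (B.card + 3)) *
          G'.numOn x (insert c (insert b (insert v (insert u A)))) := by
        rw [← numColorings_eq_numOn_univ, ← hS]
        refine numColorings_le_pow_mul fun r hr => ?_
        simp only [mem_insert, not_or] at hr
        have hrB : r ∈ B := by have := H.mem_cases r; tauto
        exact ⟨b, by simp, c, by simp, hG hbc', hG (H.isClique_right hrB hb hr.2.1),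
          hG (H.isClique_right hrB hc hr.1)⟩
    _ ≤ (x - 2) ^ (Fintype.card V - (B.card + 3)) *
          ((x - 2) * ((x - 1) * ((x - B.card) * x.descFactorial B.card))) := by
        refine Nat.mul_le_mul_left _ ((numOn_insert_le_two hc' (mem_insert_of_mem hz)
          (mem_insert_self _ _) (hG hzb) (hG hzc.symm) (hG hbc'.symm)).trans
          (Nat.mul_le_mul_left _ ((numOn_insert_le_one hb' hz (hG hzb.symm)).trans
          (Nat.mul_le_mul_left _ ?_))))
        rw [← hK, ← numOn_clique (x := x) hKc]
        refine numOn_insert_le hv (Subset.refl _) hKc fun t ht => ?_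
        rcases mem_insert.1 ht with rfl | ht
        · exact huv.symm
        · exact hG (H.adj_left t ht).2
    _ = _ := by
        rw [H.card_eq, show A.card + B.card + 2 - (B.card + 3) = B.card - 2 by omega,
          show B.card - 1 = B.card - 2 + 1 by omega]
        ring

theorem card_filter_apply_eq_le (H : G.IsInflatedPentagon A B u v) (hAB : B.card = A.card + 1) :
    ((G.coloringsOn x univ).filter fun c => c u = c v).card ≤
      (x - 2) ^ (B.card - 2) * ((x - 1) * ((x - B.card) * x.descFactorial B.card)) := by
  -- colorings with `c u = c v` are the colorings of the graph with `v` merged into `u`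
  let G' := fromRel fun s t => G.Adj s t ∨ s = u ∧ G.Adj v t
  have hG : ∀ {s t}, G.Adj s t → G'.Adj s t := fun h =>
    (fromRel_adj _ _ _).2 ⟨h.ne, Or.inl (Or.inl h)⟩
  have huB' : ∀ b ∈ B, G'.Adj u b := fun b hb => by
    rcases H.adj_right b hb with h | h
    · exact hG h
    · exact (fromRel_adj _ _ _).2 ⟨(ne_of_mem_of_not_mem hb H.fst_notMem_right).symm,
        Or.inl (Or.inr ⟨rfl, h⟩)⟩
  have hsub : ((G.coloringsOn x univ).filter fun c => c u = c v).card ≤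
      G'.numOn x (univ.erase v) := by
    refine card_le_card_of_injOn (fun c => update c v 0) (fun c hc => ?_)
      fun c hc d hd h => ?_
    · have hc := mem_filter.1 (mem_coe.1 hc)
      have hc2 := fun s t => (mem_coloringsOn.1 hc.1).2 s (mem_univ s) t (mem_univ t)
      refine mem_coe.2 (mem_coloringsOn.2 ⟨fun w hw => ?_, fun s hs t ht hst => ?_⟩)
      · have : w = v := by simpa using hw
        simp [this]
      · simp only [update_of_ne (ne_of_mem_erase hs), update_of_ne (ne_of_mem_erase ht)]
        rcases ((fromRel_adj _ _ _).1 hst).2 with (h | ⟨rfl, h⟩) | h | ⟨rfl, h⟩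
        · exact hc2 _ _ h
        · rw [hc.2]; exact hc2 _ _ h
        · exact (hc2 _ _ h).symm
        · rw [hc.2]; exact (hc2 _ _ h).symm
    · have hoff : ∀ w, w ≠ v → c w = d w := fun w hw => by
        simpa [update_of_ne hw] using congrFun h w
      funext w
      by_cases hw : w = v
      · rw [hw, ← (mem_filter.1 (mem_coe.1 hc)).2, ← (mem_filter.1 (mem_coe.1 hd)).2,
          hoff u H.ne]
      · exact hoff w hw
  refine hsub.trans ?_
  obtain ⟨b, hb, c, hc, hbc, -⟩ := H.exists_adj_pair
  have hB2 : 2 ≤ B.card := by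
    rw [← card_pair hbc]; exact card_le_card (by simp [insert_subset_iff, hb, hc])
  have huA := H.fst_notMem_left
  have hK : (insert u A).card = B.card := by rw [card_insert_of_notMem huA, hAB]
  have hKc : G'.IsClique ((insert u A : Finset V) : Set V) := fun s hs t ht hst =>
    hG (H.isClique_insert_fst hs ht hst)
  have hbA := Finset.disjoint_right.1 H.disjoint hb
  have hcA := Finset.disjoint_right.1 H.disjoint hc
  have hbu := ne_of_mem_of_not_mem hb H.fst_notMem_right
  have hcu := ne_of_mem_of_not_mem hc H.fst_notMem_right
  have hbv := ne_of_mem_of_not_mem hb H.swap.fst_notMem_right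
  have hcv := ne_of_mem_of_not_mem hc H.swap.fst_notMem_right
  have hvA := H.swap.fst_notMem_left
  have hb' : b ∉ insert u A := by simp [hbu, hbA]
  have hS : (insert b (insert u A)).card = B.card + 1 := by
    rw [card_insert_of_notMem hb', hK]
  set R : Finset V := (univ.erase v).erase c with hR
  have hRcard : R.card = A.card + B.card := by
    rw [hR, card_erase_of_mem (by simp [hcv]), card_erase_of_mem (mem_univ _), card_univ,
      H.card_eq]
    omega
  have hcR : c ∉ R := by simp [hR]
  have hSR : insert b (insert u A) ⊆ R := by
    intro w hw
    simp only [mem_insert] at hw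
    simp only [hR, mem_erase, mem_univ, and_true]
    rcases hw with rfl | rfl | hw
    · exact ⟨hbc, hbv⟩
    · exact ⟨hcu.symm, H.ne⟩
    · exact ⟨ne_of_mem_of_not_mem hw hcA, ne_of_mem_of_not_mem hw hvA⟩
  have hcl : G'.IsClique ((insert u (B.erase c) : Finset V) : Set V) :=
    isClique_insert_of_forall
      (fun s hs t ht hst => hG (H.isClique_right (mem_of_mem_erase hs) (mem_of_mem_erase ht) hst))
      fun w hw => huB' w (mem_of_mem_erase hw)
  have hclcard : (insert u (B.erase c)).card = B.card := by
    rw [card_insert_of_notMem (by simp [H.fst_notMem_right]), card_erase_of_mem hc]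
    omega
  calc G'.numOn x (univ.erase v)
      = G'.numOn x (insert c R) := by rw [hR, insert_erase (by simp [hcv])]
    _ ≤ (x - B.card) * G'.numOn x R := by
        rw [← hclcard]
        refine numOn_insert_le hcR (fun w hw => ?_) hcl fun t ht => ?_
        · rcases mem_insert.1 hw with rfl | hw
          · exact hSR (by simp)
          · simp only [hR, mem_erase, mem_univ, and_true]
            exact ⟨ne_of_mem_erase hw,
              ne_of_mem_of_not_mem (mem_of_mem_erase hw) H.swap.fst_notMem_right⟩
        · rcases mem_insert.1 ht with rfl | ht
          · exact (huB' c hc).symm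
          · exact hG (H.isClique_right hc (mem_of_mem_erase ht) (ne_of_mem_erase ht).symm)
    _ ≤ (x - B.card) * ((x - 2) ^ (R.card - (B.card + 1)) *
          G'.numOn x (insert b (insert u A))) := by
        rw [← hS]
        refine Nat.mul_le_mul_left _ (numOn_le_pow_mul hSR fun r hr hrS => ?_)
        simp only [mem_insert, not_or] at hrS
        have hrv : r ≠ v := by
          simp only [hR, mem_erase] at hr
          exact hr.2.1
        have hrB : r ∈ B := by have := H.mem_cases r; tauto
        exact ⟨u, by simp, b, by simp, huB' b hb, (huB' r hrB).symm,
          hG (H.isClique_right hrB hb hrS.1)⟩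
    _ ≤ (x - B.card) * ((x - 2) ^ (R.card - (B.card + 1)) *
          ((x - 1) * x.descFactorial B.card)) := by
        rw [← hK, ← numOn_clique (x := x) hKc, hK]
        exact Nat.mul_le_mul_left _ (Nat.mul_le_mul_left _
          (numOn_insert_le_one hb' (mem_insert_self _ _) (huB' b hb).symm))
    _ = _ := by
        rw [hRcard, show A.card + B.card - (B.card + 1) = B.card - 2 by omega]
        ring

/-- The case `#B = #A + 1` and `k = #B + 1`, in which `G` has no `k`-clique. -/
theorem numColorings_lt_of_card_eq (H : G.IsInflatedPentagon A B u v) (hB : 3 ≤ B.card)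
    (hAB : B.card = A.card + 1) (hx : B.card + 1 ≤ x) :
    G.numColorings x < x.descFactorial (B.card + 1) * earCount x B.card := by
  have hD : 0 < x.descFactorial (B.card + 1) := Nat.descFactorial_pos.2 hx
  rw [numColorings_eq_numOn_univ, numOn,
    ← card_filter_add_card_filter_not (fun c => c u = c v)]
  calc _ ≤ (x - 2) ^ (B.card - 2) * ((x - 1) * ((x - B.card) * x.descFactorial B.card)) +
        (x - 2) ^ (B.card - 1) * ((x - 1) * ((x - B.card) * x.descFactorial B.card)) :=
        Nat.add_le_add (H.card_filter_apply_eq_le hAB) (H.card_filter_apply_ne_le hB hAB)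
    _ = x.descFactorial (B.card + 1) * ((x - 2) ^ (B.card - 3) * ((x - 2) * (x - 1) ^ 2)) := by
        obtain ⟨y, rfl⟩ := Nat.exists_eq_add_of_le' (show 2 ≤ x by omega)
        rw [Nat.descFactorial_succ, show B.card - 1 = B.card - 3 + 1 + 1 by omega,
          show B.card - 2 = B.card - 3 + 1 by omega, Nat.add_sub_cancel,
          show y + 2 - 1 = y + 1 from rfl]
        ring
    _ < _ := by
        refine Nat.mul_lt_mul_of_pos_left (pow_mul_lt_earCount_of_lt_three (by omega) hB ?_) hD
        rw [earCount_three (by omega)]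
        exact Nat.mul_lt_mul_of_pos_left (Nat.lt_succ_self _) (by omega)

theorem numColorings_lt (H : G.IsInflatedPentagon A B u v) {k : ℕ} (hk : 4 ≤ k) (hx : k ≤ x)
    (hχ : G.chromaticNumber = (k : ℕ∞)) :
    G.numColorings x < x.descFactorial k * earCount x (Fintype.card V - k) := by
  have hcol : ∀ {m : ℕ}, G.Colorable m → k ≤ m := fun h => by
    have := chromaticNumber_le_iff_colorable.2 h
    rw [hχ] at this
    exact_mod_cast this
  have hcl : ∀ {K : Finset V}, G.IsClique (K : Set V) → K.card ≤ k := fun h => by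
    have := h.card_le_chromaticNumber
    rw [hχ] at this
    exact_mod_cast this
  have hA : A.card + 1 ≤ k := by
    rw [← card_insert_of_notMem H.fst_notMem_left]; exact hcl H.isClique_insert_fst
  have hB : B.card ≤ k := hcl H.isClique_right
  rw [H.card_eq]
  rcases Nat.lt_or_ge A.card B.card with hAB | hAB
  · have hk' : k ≤ B.card + 1 := hcol (colorable_card_add_one H.disjoint H.mem_iff
      H.not_adj_ends H.not_adj hAB.le)
    rcases hB.eq_or_lt with rfl | hB
    · rw [show A.card + B.card + 2 - B.card = A.card + 2 by omega]
      exact H.numColorings_lt_of_right hk hx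
    · obtain rfl : k = B.card + 1 := by omega
      have hAB' : B.card = A.card + 1 := by
        by_contra hne
        have := hcol (H.colorable_card_right (by omega))
        omega
      rw [show A.card + B.card + 2 - (B.card + 1) = B.card by omega]
      exact H.numColorings_lt_of_card_eq (by omega) hAB' hx
  · obtain rfl : k = A.card + 1 := le_antisymm (hcol (colorable_card_add_one H.disjoint.symm
      (fun w => by rw [or_comm]; exact H.mem_iff w) H.not_adj_ends
      (fun b hb a ha h => H.not_adj a ha b hb h.symm) hAB)) hA
    rw [show A.card + B.card + 2 - (A.card + 1) = B.card + 1 by omega]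
    exact H.numColorings_lt_of_left (by omega) hx

end IsInflatedPentagon

end InflatedPentagon

end SimpleGraph

theorem theorem5 {V : Type*} [Fintype V] (G : SimpleGraph V) (n k : ℕ)
    (hn : Fintype.card V = n) (hk : 4 ≤ k) (hkn : k < n)
    (hconn : G.IsVertexConnected 2) (hchrom : G.chromaticNumber = (k : ℕ∞))
    (hindep : G.indepNum = 2) (hkappa : G.vertexConnectivity = 2)
    (x : ℕ) (hx : k ≤ x) :
    (G.numColorings x : ℤ) ≤ chromaticBound n k (x : ℤ) ∧
      ((G.numColorings x : ℤ) = chromaticBound n k (x : ℤ) ↔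
        (Nonempty (G ≃g SimpleGraph.cliqueWithEar (k + 1) k) ∨
          Nonempty (G ≃g SimpleGraph.cliqueWithEar (k + 2) k))) := by
  subst hn
  have : NeZero x := ⟨by omega⟩
  rw [SimpleGraph.chromaticBound_eq (by omega) (by omega), Nat.cast_le, Nat.cast_inj]
  have key : G.numColorings x <
        x.descFactorial k * SimpleGraph.earCount x (Fintype.card V - k) ∨
      G.numColorings x = x.descFactorial k * SimpleGraph.earCount x (Fintype.card V - k) ∧
        (Nonempty (G ≃g SimpleGraph.cliqueWithEar (k + 1) k) ∨
          Nonempty (G ≃g SimpleGraph.cliqueWithEar (k + 2) k)) := by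
    rcases SimpleGraph.exists_cobipartite_or_isInflatedPentagon (by omega) hconn hkappa hindep
      with ⟨Y, hY, hY'⟩ | ⟨A, B, u, v, H⟩
    · exact SimpleGraph.numColorings_of_cobipartite hconn hY hY' hk hx hkn hchrom
    · exact Or.inl (H.numColorings_lt hk hx hchrom)
  refine ⟨key.elim le_of_lt fun h => h.1.le, fun h => ?_, ?_⟩
  · exact (key.resolve_left h.not_lt).2
  · have hcard : ∀ {m : ℕ}, (G ≃g SimpleGraph.cliqueWithEar m k) → Fintype.card V = m :=
      fun e => by simpa using Fintype.card_congr e.toEquiv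
    rintro (⟨⟨e⟩⟩ | ⟨⟨e⟩⟩)
    · rw [hcard e, Nat.add_sub_cancel_left, SimpleGraph.numColorings_congr e,
        SimpleGraph.numColorings_cliqueWithEar_one (by omega)]
    · rw [hcard e, Nat.add_sub_cancel_left, SimpleGraph.numColorings_congr e,
        SimpleGraph.numColorings_cliqueWithEar_two (by omega) (by omega)]
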